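/- Fix integers $N\ge 2$ (parties) and $d\ge 0$, and let $\mathcal S^{d,N}$ be the set of density matrices on $(\mathbb C^d)^{\otimes N}$. Blocks of parties below are arbitrary non-empty subsets of $\{1,\dots,N\}$. Let $\mathcal P$ be the set of states of the form $\sigma^{[1]}\otimes\cdots\otimes\sigma^{[m]}$, where $\{1,\dots,N\}$ is partitioned into $m$ blocks of at most $N-1$ parties each and $\sigma^{[i]}$ is a state of the $i$-th block. Let $\mathcal C$ be the set of states $\sum_{\alpha} p_{\alpha}|\alpha_1\cdots\alpha_m\rangle\langle\alpha_1\cdots\alpha_m|$, where again the parties are partitioned into blocks of at most $N-1$ parties, $(|\alpha_i\rangle)_{\alpha_i}$ is an orthonormal basis of the space of the $i$-th block, and $(p_\alpha)$ is a probability distribution. Let $\mathcal E$ be the convex hull of $\mathcal P$. Let $H(\rho\|\sigma)=\operatorname{tr}\rho\log\rho-\operatorname{tr}\rho\log\sigma$ if $\operatorname{supp}\rho\subseteq\operatorname{supp}\sigma$, and $H(\rho\|\sigma)=\infty$ otherwise. Define $\mathcal S^{d,N}_{GMT}$, $\mathcal S^{d,N}_{GMD}$, $\mathcal S^{d,N}_{GME}$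 (genuine multipartite total correlation, discord, entanglement) as the sets of states $\rho\in\mathcal S^{d,N}$ with $\inf_{\sigma} H(\rho\|\sigma)>0$, where $\sigma$ ranges over $\mathcal P$, $\mathcal C$, $\mathcal E$ respectively. A measurement of a party is a POVM on $\mathbb C^d$ with finitely many outcomes. A state $\rho$ has a hybrid local hidden state model if there are weights $w_A\ge 0$ with $\sum_A w_A=1$, indexed by the directed bipartitions (ordered pairs $(A,A^c)$ with $A,A^c\ne\emptyset$), and for each $A$ a probability space $(\Lambda_A,\mu_A)$, response functions $p_A(a|x_A,\lambda)$ (for each tuple $x_A$ of measurements of the parties in $A$ a probability distribution over their joint outcomes $a$, measurable in $\lambda$) and a measurable family of states $\rho^A_\lambda$ of the parties in $A^c$, such that for all local measurements $x_1,\dots,x_N$ and all outcomes $(a,b)$ (with $a$ in $A$ and $b$ in $A^c$) $$\operatorname{tr}\Big[\rho\,\bigotimes_{i} x_i(a_i)\Big]=\sum_{A} w_A\int p_A(a|x_A,\lambda)\,\operatorname{tr}\Big[\rho^A_\lambda\bigotimes_{i\in A^c}x_i(b_i)\Big]\,d\mu_A(\lambda).$$ It has a hybrid local hidden variable model if this holds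 with the last trace replaced by arbitrary response functions $p_A(b|x_{A^c},\lambda)$ of the parties in $A^c$. Let $\mathcal S^{d,N}_{GMS}$ (genuine multipartite steering) and $\mathcal S^{d,N}_{GMNL}$ (genuine multipartite nonlocality) be the sets of states that have no hybrid local hidden state model and no hybrid local hidden variable model, respectively. **Theorem.** For all $N\ge 2$ and all $d$, $$\mathcal S^{d,N}_{GMT}\supseteq\mathcal S^{d,N}_{GMD}\supseteq\mathcal S^{d,N}_{GME}\supseteq\mathcal S^{d,N}_{GMS}\supseteq\mathcal S^{d,N}_{GMNL},$$ and for all $N\ge 2$ and $d\ge 2$, $$\mathcal S^{d,N}_{GMT}\supsetneq\mathcal S^{d,N}_{GME}\supsetneq\mathcal S^{d,N}_{GMS}.$$ -/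

import Mathlib

open scoped ComplexOrder

noncomputable section

namespace GenuineCorr

/-! ### States of several qudits

The Hilbert space of a finite family `ι` of qudits of dimension `d` is `(ℂ^d)^{⊗ ι}`. Its
standard product basis is indexed by `ι → Fin d`, and operators are matrices in that basis. -/

/-- Operators on the qudits in `ι`. -/
abbrev Op (ι : Type) (d : ℕ) : Type := Matrix (ι → Fin d) (ι → Fin d) ℂ

/-- Density matrices: positive semidefinite of trace one. -/
def IsState {n : Type} [Fintype n] (ρ : Matrix n n ℂ) : Prop :=
  ρ.PosSemidef ∧ ρ.trace = 1

/-- The `N`-partite qudit states of local dimension `d`. -/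
def states (N d : ℕ) : Set (Op (Fin N) d) := {ρ | IsState ρ}

/-- The tensor product of one operator per block of a partition of the parties, as an operator
on all the parties (every factor acts on the parties of its block). -/
def blockTensor {N d : ℕ} (P : Finpartition (Finset.univ : Finset (Fin N)))
    (σ : ∀ B : P.parts, Op B.1 d) : Op (Fin N) d :=
  fun r c => ∏ B : P.parts, σ B (fun i : B.1 => r i) (fun i : B.1 => c i)

/-- `k`-product states: tensor products of states of blocks of at most `k` parties. -/
def productStates (N d k : ℕ) : Set (Op (Fin N) d) :=
  {ρ | ∃ (P : Finpartition (Finset.univ : Finset (Fin N))) (σ : ∀ B : P.parts, Op B.1 d),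
    (∀ B ∈ P.parts, B.card ≤ k) ∧ (∀ B, IsState (σ B)) ∧ ρ = blockTensor P σ}

/-- The rank-one operator `|v⟩⟨v|`. -/
def ketbra {n : Type} [Fintype n] (v : EuclideanSpace ℂ n) : Matrix n n ℂ :=
  fun i j => v i * star (v j)

/-- `k`-classical states: for a partition into blocks of at most `k` parties and an orthonormal
basis of the space of every block, the mixtures `∑ p_α |α⟩⟨α|` of the resulting product basis. -/
def classicalStates (N d k : ℕ) : Set (Op (Fin N) d) :=
  {ρ | ∃ (P : Finpartition (Finset.univ : Finset (Fin N)))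
    (b : ∀ B : P.parts,
      OrthonormalBasis (B.1 → Fin d) ℂ (EuclideanSpace ℂ (B.1 → Fin d)))
    (p : (∀ B : P.parts, (B.1 → Fin d)) → ℝ),
    (∀ B ∈ P.parts, B.card ≤ k) ∧ (∀ α, 0 ≤ p α) ∧ ∑ α, p α = 1 ∧
      ρ = ∑ α, p α • blockTensor P (fun B => ketbra (b B (α B)))}

/-- `k`-separable states: probabilistic mixtures of `k`-product states, whose partitions may
differ from one term to another. -/
def separableStates (N d k : ℕ) : Set (Op (Fin N) d) :=
  convexHull ℝ (productStates N d k)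

/-! ### Relative entropy and the correlations measured by it -/

/-- The support of a Hermitian matrix, that is, its range. -/
def supp {n : Type} [Fintype n] (A : Matrix n n ℂ) : Submodule ℂ (n → ℂ) :=
  LinearMap.range A.mulVecLin

open Classical in
/-- Quantum relative entropy `H(ρ‖σ) = tr ρ log ρ - tr ρ log σ`, and `∞` unless the support of
`ρ` lies in that of `σ`. The logarithm is taken by functional calculus, with `log 0 = 0` on the
kernels, which contribute nothing. -/
def relEntropy {n : Type} [Fintype n] [DecidableEq n] (ρ σ : Matrix n n ℂ) : EReal :=
  if supp ρ ≤ supp σ then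
    (((ρ * cfc Real.log ρ).trace - (ρ * cfc Real.log σ).trace).re : ℝ)
  else ⊤

/-- The relative-entropy distance of `ρ` from the set `C`. -/
def entropyDist {n : Type} [Fintype n] [DecidableEq n] (C : Set (Matrix n n ℂ))
    (ρ : Matrix n n ℂ) : EReal :=
  ⨅ σ ∈ C, relEntropy ρ σ

/-- Genuine total correlation of order higher than `k`. -/
def dTot (N d k : ℕ) (ρ : Op (Fin N) d) : EReal := entropyDist (productStates N d k) ρ

/-- Genuine discord of order higher than `k`. -/
def dDis (N d k : ℕ) (ρ : Op (Fin N) d) : EReal := entropyDist (classicalStates N d k) ρ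

/-- Genuine entanglement of order higher than `k`. -/
def dEnt (N d k : ℕ) (ρ : Op (Fin N) d) : EReal := entropyDist (separableStates N d k) ρ

/-- States with genuine multipartite total correlations. -/
def GMT (N d : ℕ) : Set (Op (Fin N) d) := {ρ ∈ states N d | 0 < dTot N d (N - 1) ρ}

/-- States with genuine multipartite discord. -/
def GMD (N d : ℕ) : Set (Op (Fin N) d) := {ρ ∈ states N d | 0 < dDis N d (N - 1) ρ}

/-- Genuinely multipartite entangled states. -/
def GME (N d : ℕ) : Set (Op (Fin N) d) := {ρ ∈ states N d | 0 < dEnt N d (N - 1) ρ}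

/-! ### Measurements and hidden-variable models -/

/-- A POVM on one qudit, with finitely many outcomes. -/
structure Measurement (d : ℕ) where
  numOutcomes : ℕ
  effect : Fin numOutcomes → Matrix (Fin d) (Fin d) ℂ
  posSemidef : ∀ a, (effect a).PosSemidef
  sum_effect : ∑ a, effect a = 1

/-- The joint outcomes of the measurements `x i`, `i : ι`. -/
abbrev Outcome {ι : Type} {d : ℕ} (x : ι → Measurement d) : Type :=
  ∀ i, Fin (x i).numOutcomes

/-- The effect `⨂ i, x_i(a_i)` of the joint outcome `a` of local measurements `x`. -/
def jointEffect {ι : Type} [Fintype ι] {d : ℕ} (x : ι → Measurement d) (a : Outcome x) :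
    Op ι d :=
  fun r c => ∏ i, (x i).effect (a i) (r i) (c i)

/-- The quantum probability of the joint outcome `a` of local measurements `x` in state `ρ`. -/
def born {ι : Type} [Fintype ι] [DecidableEq ι] {d : ℕ} (ρ : Op ι d) (x : ι → Measurement d)
    (a : Outcome x) : ℝ :=
  (ρ * jointEffect x a).trace.re

/-- A response `p(a | x, l)` of a group `ι` of parties to the hidden variable `l`: for all
measurements a probability distribution over the joint outcomes, measurable in `l`. No structure
inside the group is demanded. -/
structure Response (ι : Type) [Fintype ι] [DecidableEq ι] (d : ℕ) (Λ : Type)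
    [MeasurableSpace Λ] where
  prob : ∀ x : ι → Measurement d, Outcome x → Λ → ℝ
  measurable : ∀ x a, Measurable (prob x a)
  nonneg : ∀ x a l, 0 ≤ prob x a l
  sum_eq_one : ∀ x l, ∑ a, prob x a l = 1

/-- A measurable family of states of a group `ι` of parties. -/
structure HiddenState (ι : Type) [Fintype ι] [DecidableEq ι] (d : ℕ) (Λ : Type)
    [MeasurableSpace Λ] where
  state : Λ → Op ι d
  measurable : ∀ r c, Measurable fun l => state l r c
  isState : ∀ l, IsState (state l)

/-- A local hidden variable model for the bipartition `A | Aᶜ`. -/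
structure LHVModel (N d : ℕ) (A : Finset (Fin N)) where
  Λ : Type
  [measurableSpace : MeasurableSpace Λ]
  μ : MeasureTheory.Measure Λ
  isProb : MeasureTheory.IsProbabilityMeasure μ
  left : Response A d Λ
  right : Response (Aᶜ : Finset (Fin N)) d Λ

attribute [instance] LHVModel.measurableSpace

/-- The statistics `∫ p(a | x_A, l) p(b | x_{Aᶜ}, l) dμ(l)` of the model. -/
def LHVModel.prob {N d : ℕ} {A : Finset (Fin N)} (M : LHVModel N d A)
    (x : Fin N → Measurement d) (a : Outcome x) : ℝ :=
  ∫ l, M.left.prob (fun i => x i) (fun i => a i) l *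
    M.right.prob (fun i => x i) (fun i => a i) l ∂M.μ

/-- A local hidden state model from `A` to `Aᶜ`: the response of `A` is arbitrary, that of `Aᶜ`
comes from measuring a quantum state. -/
structure LHSModel (N d : ℕ) (A : Finset (Fin N)) where
  Λ : Type
  [measurableSpace : MeasurableSpace Λ]
  μ : MeasureTheory.Measure Λ
  isProb : MeasureTheory.IsProbabilityMeasure μ
  left : Response A d Λ
  right : HiddenState (Aᶜ : Finset (Fin N)) d Λ

attribute [instance] LHSModel.measurableSpace

/-- The statistics `∫ p(a | x_A, l) tr(ρ_l x_{Aᶜ}(b)) dμ(l)` of the model. -/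
def LHSModel.prob {N d : ℕ} {A : Finset (Fin N)} (M : LHSModel N d A)
    (x : Fin N → Measurement d) (a : Outcome x) : ℝ :=
  ∫ l, M.left.prob (fun i => x i) (fun i => a i) l *
    born (M.right.state l) (fun i => x i) (fun i => a i) ∂M.μ

/-- Directed bipartitions of the parties, given by their first block `A`; the second one is `Aᶜ`.
A bipartition without direction is listed twice, as `A` and as `Aᶜ`. In a mixture over
bipartitions this is immaterial: it only splits the weight. -/
abbrev Bipartition (N : ℕ) : Type := {A : Finset (Fin N) // A.Nonempty ∧ Aᶜ.Nonempty}

/-- The statistics of `ρ` under all local POVMs come from a mixture over bipartitions of local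
hidden variable models. -/
def HybridLHV {N d : ℕ} (ρ : Op (Fin N) d) : Prop :=
  ∃ (w : Bipartition N → ℝ) (M : ∀ A : Bipartition N, LHVModel N d A.1),
    (∀ A, 0 ≤ w A) ∧ ∑ A, w A = 1 ∧
      ∀ (x : Fin N → Measurement d) (a : Outcome x), born ρ x a = ∑ A, w A * (M A).prob x a

/-- The statistics of `ρ` under all local POVMs come from a mixture over directed bipartitions of
local hidden state models. -/
def HybridLHS {N d : ℕ} (ρ : Op (Fin N) d) : Prop :=
  ∃ (w : Bipartition N → ℝ) (M : ∀ A : Bipartition N, LHSModel N d A.1),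
    (∀ A, 0 ≤ w A) ∧ ∑ A, w A = 1 ∧
      ∀ (x : Fin N → Measurement d) (a : Outcome x), born ρ x a = ∑ A, w A * (M A).prob x a

/-- Genuinely multipartite steerable states. -/
def GMS (N d : ℕ) : Set (Op (Fin N) d) := {ρ ∈ states N d | ¬ HybridLHS ρ}

/-- Genuinely multipartite nonlocal states. -/
def GMNL (N d : ℕ) : Set (Op (Fin N) d) := {ρ ∈ states N d | ¬ HybridLHV ρ}

end GenuineCorr

end

/-!
The inclusions come from `productStates ⊆ classicalStates ⊆ separableStates` (diagonalize the
factors; expand the mixture), since a distance to a larger set is smaller, together with three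
further facts. Relative entropy dominates a quarter of the squared Frobenius distance
(`relEntropy_ge_frobenius`), and the product and the separable states form compact sets, so the
states at entropy distance zero from one of these sets are just its members (`entropyDist_pos`).
Separable states have a hybrid local hidden state model (`hybridLHS_of_mem_separableStates`): the
term of the decomposition is the hidden variable. Measuring the hidden states turns such a model
into a hidden variable model (`HybridLHS.hybridLHV`).

The mixture of `|0…0⟩` and `|1…1⟩` is separable and not a product, which separates total
correlation from entanglement.

Entanglement and steering are separated by an explicit state. Let `Ω = |00⟩ + |11⟩`. The two-qubit
state `(|Ω⟩⟨Ω| + (½ I + |0⟩⟨0|) ⊗ I) / 6` is spread over the parties by encoding the first qubit in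
the span of `|0…0⟩` and `|1…1⟩` on a set `A` of parties and the second one in the same way on `Aᶜ`.

* It is genuinely multipartite entangled: on every product across a bipartition, positivity of the
  factors bounds the coherence between `0…0` and `1…1` by two other diagonal entries, and the state
  violates a linear form of this bound (`entanglementWitness_nonneg`,
  `entanglementWitness_spreadState_neg`).
* It has a local hidden state model with only six hidden states, the vertices `±eᵢ` of the
  octahedron in the Bloch ball. To the hidden state `±eᵢ` and the effect whose transpose is
  `m₀ + m·σ` the model assigns the weight `(m₀ ± mᵢ)² / 2m₀ + (m₀² - |m|²) / 6m₀`. Weighted in this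
  way the hidden states average to a linear function of the effect (`sum_pref_mul`), a multiple of
  the one that belongs to the isotropic state of visibility `½`. As the weight is at most `m₀ ± mᵢ`,
  the weights of a whole measurement add up to at most one (`sum_pref_le_one`). What is missing is
  filled up by the outcome distribution of `|0⟩`, which contributes the noise `|0⟩⟨0| ⊗ I`. This
  noise is so asymmetric that it does not destroy the entanglement.
-/

namespace GenuineCorr

/-! ### Relative entropy bounds the Frobenius distance -/

/-- The bound `log x ≤ x - 1` at `x = √(q / p)` gives the lower bound `p - q + (√p - √q)²`. The last
hypothesis excludes the junk value `log 0 = 0`. -/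
lemma mul_log_sub_mul_log_ge {p q : ℝ} (hp : 0 ≤ p) (hp1 : p ≤ 1) (hq : 0 ≤ q) (hq1 : q ≤ 1)
    (h0 : q = 0 → p = 0) :
    p - q + (p - q) ^ 2 / 4 ≤ p * Real.log p - p * Real.log q := by
  rcases hp.eq_or_lt with rfl | hp'
  · nlinarith
  have hq' : 0 < q := lt_of_le_of_ne hq fun h => hp'.ne' (h0 h.symm)
  obtain ⟨a, ha, rfl⟩ : ∃ a, 0 < a ∧ p = a ^ 2 := ⟨√p, Real.sqrt_pos.2 hp', (Real.sq_sqrt hp).symm⟩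
  obtain ⟨b, hb, rfl⟩ : ∃ b, 0 < b ∧ q = b ^ 2 := ⟨√q, Real.sqrt_pos.2 hq', (Real.sq_sqrt hq).symm⟩
  have ha1 : a ≤ 1 := by nlinarith
  have hb1 : b ≤ 1 := by nlinarith
  have h := Real.log_le_sub_one_of_pos (div_pos hb ha)
  rw [Real.log_div hb.ne' ha.ne'] at h
  rw [Real.log_pow, Real.log_pow]
  have h2 : a ^ 2 * (Real.log b - Real.log a) ≤ a ^ 2 * (b / a - 1) := by gcongr
  have h3 : a ^ 2 * (b / a - 1) = a * b - a ^ 2 := by field_simp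
  have h4 : (a ^ 2 - b ^ 2) ^ 2 ≤ 4 * (a - b) ^ 2 := by
    have : (a + b) ^ 2 ≤ 4 := by nlinarith
    nlinarith [mul_le_mul_of_nonneg_left this (sq_nonneg (a - b))]
  push_cast
  nlinarith

lemma trace_mul_self_of_isHermitian {n : Type} [Fintype n] {A : Matrix n n ℂ}
    (hA : A.IsHermitian) :
    (A * A).trace = ((∑ i, ∑ j, Complex.normSq (A i j) : ℝ) : ℂ) := by
  push_cast
  refine Finset.sum_congr rfl fun i _ => ?_
  rw [Matrix.diag_apply, Matrix.mul_apply]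
  refine Finset.sum_congr rfl fun j _ => ?_
  rw [← Complex.mul_conj, ← hA.apply j i]
  rfl

section Spectral

variable {n : Type} [Fintype n] [DecidableEq n] {A B : Matrix n n ℂ}

/-- The squared overlap `|⟨u_i, v_j⟩|²` of the eigenvectors of two Hermitian matrices. -/
noncomputable def overlap (hA : A.IsHermitian) (hB : B.IsHermitian) (i j : n) : ℝ :=
  Complex.normSq ((star (hA.eigenvectorUnitary : Matrix n n ℂ) * hB.eigenvectorUnitary) i j)

lemma overlap_nonneg (hA : A.IsHermitian) (hB : B.IsHermitian) (i j : n) :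
    0 ≤ overlap hA hB i j := Complex.normSq_nonneg _

/-- The spectral expansion of `tr f(A) g(B)`, through which all traces in the relative entropy and
in the Frobenius distance are compared. -/
lemma trace_cfc_mul_cfc (hA : A.IsHermitian) (hB : B.IsHermitian) (f g : ℝ → ℝ) :
    (cfc f A * cfc g B).trace =
      ((∑ i, ∑ j, overlap hA hB i j * (f (hA.eigenvalues i) * g (hB.eigenvalues j)) : ℝ) : ℂ) := by
  rw [hA.cfc_eq, hB.cfc_eq, Matrix.IsHermitian.cfc, Matrix.IsHermitian.cfc,
    Unitary.conjStarAlgAut_apply, Unitary.conjStarAlgAut_apply]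
  set U : Matrix n n ℂ := (hA.eigenvectorUnitary : Matrix n n ℂ) with hU
  set V : Matrix n n ℂ := (hB.eigenvectorUnitary : Matrix n n ℂ) with hV
  set p := Matrix.diagonal (RCLike.ofReal (K := ℂ) ∘ f ∘ hA.eigenvalues)
  set q := Matrix.diagonal (RCLike.ofReal (K := ℂ) ∘ g ∘ hB.eigenvalues)
  have h1 : (U * p * star U * (V * q * star V)).trace
      = (p * (star U * V) * (q * star (star U * V))).trace := by
    rw [show U * p * star U * (V * q * star V) = U * (p * star U * (V * q * star V)) by
      simp only [mul_assoc], Matrix.trace_mul_comm]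
    simp only [star_mul, star_star, mul_assoc]
  rw [h1, Matrix.trace]
  push_cast
  refine Finset.sum_congr rfl fun i _ => ?_
  rw [Matrix.diag_apply, Matrix.mul_apply]
  refine Finset.sum_congr rfl fun j _ => ?_
  have hov : (overlap hA hB i j : ℂ) = (star U * V) i j * star ((star U * V) i j) := by
    rw [overlap, ← hU, ← hV, Complex.star_def, Complex.mul_conj]
  rw [Matrix.diagonal_mul, Matrix.diagonal_mul, Matrix.star_apply, hov]
  simp only [Function.comp_apply, Complex.coe_algebraMap]
  ring

lemma sum_overlap_right (hA : A.IsHermitian) (hB : B.IsHermitian) (i : n) :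
    ∑ j, overlap hA hB i j = 1 := by
  set U : Matrix n n ℂ := (hA.eigenvectorUnitary : Matrix n n ℂ) with hU
  set V : Matrix n n ℂ := (hB.eigenvectorUnitary : Matrix n n ℂ) with hV
  have h : (star U * V) * star (star U * V) = 1 := by
    have hVV : V * star V = 1 := Unitary.coe_mul_star_self hB.eigenvectorUnitary
    have hUU : star U * U = 1 := Unitary.coe_star_mul_self hA.eigenvectorUnitary
    rw [star_mul, star_star, mul_assoc, ← mul_assoc V, hVV, one_mul, hUU]
  have := congr_fun (congr_fun h i) i
  rw [Matrix.mul_apply, Matrix.one_apply_eq] at this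
  have h2 : ((∑ j, overlap hA hB i j : ℝ) : ℂ) = 1 := by
    rw [← this]
    push_cast
    refine Finset.sum_congr rfl fun j _ => ?_
    simp only [overlap, ← hU, ← hV, Matrix.star_apply, Complex.star_def, Complex.mul_conj]
  exact_mod_cast h2

lemma sum_overlap_left (hA : A.IsHermitian) (hB : B.IsHermitian) (j : n) :
    ∑ i, overlap hA hB i j = 1 := by
  rw [← sum_overlap_right hB hA j]
  refine Finset.sum_congr rfl fun i _ => ?_
  unfold overlap
  rw [← Complex.normSq_conj, ← Complex.star_def, ← Matrix.star_apply, star_mul, star_star]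

lemma IsState.eigenvalues_nonneg (h : IsState A) (i : n) : 0 ≤ h.1.1.eigenvalues i :=
  h.1.eigenvalues_nonneg i

lemma IsState.sum_eigenvalues (h : IsState A) : ∑ i, h.1.1.eigenvalues i = 1 := by
  have := h.1.1.trace_eq_sum_eigenvalues.symm.trans h.2
  simp only [Complex.coe_algebraMap] at this
  exact_mod_cast this

lemma IsState.eigenvalues_le_one (h : IsState A) (i : n) : h.1.1.eigenvalues i ≤ 1 := by
  rw [← h.sum_eigenvalues]
  exact Finset.single_le_sum (fun j _ => h.eigenvalues_nonneg j) (Finset.mem_univ i)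

/-- If the range of `A` lies in that of `B`, then eigenvectors of `A` to nonzero eigenvalues are
orthogonal to the kernel of `B`. -/
lemma overlap_mul_eigenvalue_eq_zero (hA : A.IsHermitian) (hB : B.IsHermitian)
    (hsupp : supp A ≤ supp B) (i j : n) (hj : hB.eigenvalues j = 0) :
    overlap hA hB i j * hA.eigenvalues i = 0 := by
  set u : n → ℂ := ⇑(hA.eigenvectorBasis i) with hu
  set v : n → ℂ := ⇑(hB.eigenvectorBasis j) with hv
  have hBv : B.mulVec v = 0 := by
    rw [hv, hB.mulVec_eigenvectorBasis, hj, zero_smul]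
  have hAu : A.mulVec u = hA.eigenvalues i • u := hA.mulVec_eigenvectorBasis i
  obtain ⟨w, hw⟩ : A.mulVec u ∈ supp B := hsupp ⟨u, rfl⟩
  have horth : star v ⬝ᵥ A.mulVec u = 0 := by
    rw [← hw, Matrix.mulVecLin_apply, Matrix.dotProduct_mulVec]
    have : Matrix.vecMul (star v) B = 0 := by
      rw [← hB.eq, ← Matrix.star_mulVec, hBv, star_zero]
    rw [this, zero_dotProduct]
  rw [hAu, dotProduct_smul] at horth
  have hov : overlap hA hB i j = Complex.normSq (star v ⬝ᵥ u) := by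
    unfold overlap
    rw [← Complex.normSq_conj, ← Complex.star_def, ← Matrix.star_apply, star_mul, star_star,
      Matrix.mul_apply]
    rfl
  rcases smul_eq_zero.1 horth with h | h
  · rw [h, mul_zero]
  · rw [hov, h, map_zero, zero_mul]

/-- A weak form of Pinsker's inequality, by a comparison of the spectral expansions term by
term. -/
theorem relEntropy_ge_frobenius (hA : IsState A) (hB : IsState B) :
    (((∑ i, ∑ j, Complex.normSq (A i j - B i j)) / 4 : ℝ) : EReal) ≤ relEntropy A B := by
  unfold relEntropy
  split_ifs with hsupp
  swap
  · exact le_top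
  rw [EReal.coe_le_coe_iff]
  set D := overlap hA.1.1 hB.1.1 with hD
  set p := hA.1.1.eigenvalues with hp
  set q := hB.1.1.eigenvalues with hq
  have key := fun f g => trace_cfc_mul_cfc hA.1.1 hB.1.1 f g
  have idA : cfc (fun x : ℝ => x) A = A := cfc_id' ℝ A hA.1.1
  have idB : cfc (fun x : ℝ => x) B = B := cfc_id' ℝ B hB.1.1
  have oneA : cfc (fun _ : ℝ => (1 : ℝ)) A = 1 := cfc_const_one ℝ A hA.1.1
  have oneB : cfc (fun _ : ℝ => (1 : ℝ)) B = 1 := cfc_const_one ℝ B hB.1.1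
  have mulA : cfc (fun x : ℝ => x * Real.log x) A = A * cfc Real.log A := by
    have hfin : (spectrum ℝ A).Finite := Matrix.finite_real_spectrum
    rw [cfc_mul (fun x : ℝ => x) Real.log A (hfin.continuousOn _) (hfin.continuousOn _), idA]
  have sqA : cfc (fun x : ℝ => x * x) A = A * A := by
    rw [cfc_mul (fun x : ℝ => x) (fun x : ℝ => x) A, idA]
  have sqB : cfc (fun x : ℝ => x * x) B = B * B := by
    rw [cfc_mul (fun x : ℝ => x) (fun x : ℝ => x) B, idB]
  have t1 := key (fun x => x * Real.log x) (fun _ => 1)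
  have t2 := key (fun x => x) Real.log
  have t3 := key (fun x => x * x) (fun _ => 1)
  have t4 := key (fun x => x) (fun x => x)
  have t5 := key (fun _ => 1) (fun x => x * x)
  rw [mulA, oneB, mul_one] at t1
  rw [idA] at t2
  rw [sqA, oneB, mul_one] at t3
  rw [idA, idB] at t4
  rw [oneA, sqB, one_mul] at t5
  have hfrob : ∑ i, ∑ j, Complex.normSq (A i j - B i j) =
      ∑ i, ∑ j, D i j * (p i - q j) ^ 2 := by
    have h := trace_mul_self_of_isHermitian (hA.1.1.sub hB.1.1)
    have h' : ((A - B) * (A - B)).trace = (A * A).trace - 2 * (A * B).trace + (B * B).trace := by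
      rw [sub_mul, mul_sub, mul_sub]
      simp only [Matrix.trace_sub]
      rw [Matrix.trace_mul_comm B A]
      ring
    rw [h', t3, t4, t5] at h
    simp only [Matrix.sub_apply] at h
    have h2 := h.symm
    norm_cast at h2
    rw [h2]
    simp only [Finset.mul_sum, ← Finset.sum_sub_distrib, ← Finset.sum_add_distrib]
    refine Finset.sum_congr rfl fun i _ => Finset.sum_congr rfl fun j _ => ?_
    ring
  have hzero : ∑ i, ∑ j, D i j * (p i - q j) = 0 := by
    simp only [mul_sub, Finset.sum_sub_distrib]
    rw [Finset.sum_comm (f := fun i j => D i j * q j)]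
    simp only [← Finset.sum_mul, hD, sum_overlap_right, sum_overlap_left, one_mul, hp, hq,
      hA.sum_eigenvalues, hB.sum_eigenvalues, sub_self]
  rw [t1, t2, ← Complex.ofReal_sub, Complex.ofReal_re, hfrob, ← add_zero (_ / 4), ← hzero,
    Finset.sum_div, ← Finset.sum_add_distrib, ← Finset.sum_sub_distrib]
  refine Finset.sum_le_sum fun i _ => ?_
  rw [Finset.sum_div, ← Finset.sum_add_distrib, ← Finset.sum_sub_distrib]
  refine Finset.sum_le_sum fun j _ => ?_
  -- terms of zero overlap have to be set aside: `q j = 0 < p i` may occur in them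
  have hz := overlap_mul_eigenvalue_eq_zero hA.1.1 hB.1.1 hsupp i j
  have hDn : 0 ≤ D i j := overlap_nonneg _ _ i j
  rcases hDn.eq_or_lt with h0 | hpos
  · have h0' : overlap hA.1.1 hB.1.1 i j = 0 := h0.symm
    simp [hD, h0']
  have := mul_log_sub_mul_log_ge (hA.eigenvalues_nonneg i) (hA.eigenvalues_le_one i)
    (hB.eigenvalues_nonneg j) (hB.eigenvalues_le_one j)
    (fun h => (mul_eq_zero.1 (hz h)).resolve_left hpos.ne')
  have := mul_le_mul_of_nonneg_left this hDn
  nlinarith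

lemma relEntropy_self (A : Matrix n n ℂ) : relEntropy A A = 0 := by
  simp [relEntropy]

lemma entropyDist_le_zero {C : Set (Matrix n n ℂ)} (hA : A ∈ C) : entropyDist C A ≤ 0 :=
  (iInf₂_le A hA).trans_eq (relEntropy_self A)

lemma entropyDist_anti {C D : Set (Matrix n n ℂ)} (h : C ⊆ D) :
    entropyDist D A ≤ entropyDist C A :=
  biInf_mono h

theorem entropyDist_pos {C : Set (Matrix n n ℂ)} (hC : IsCompact C) (hCs : ∀ B ∈ C, IsState B)
    (hA : IsState A) (hAC : A ∉ C) : 0 < entropyDist C A := by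
  rcases C.eq_empty_or_nonempty with rfl | hne
  · simp [entropyDist]
  have hcont : Continuous fun B : Matrix n n ℂ =>
      (∑ i, ∑ j, Complex.normSq (A i j - B i j)) / 4 := by
    refine Continuous.div_const ?_ _
    refine continuous_finsetSum _ fun i _ => continuous_finsetSum _ fun j _ => ?_
    exact Complex.continuous_normSq.comp (continuous_const.sub (continuous_id.matrix_elem i j))
  obtain ⟨B₀, hB₀, hmin⟩ := hC.exists_isMinOn hne hcont.continuousOn
  have hpos : 0 < (∑ i, ∑ j, Complex.normSq (A i j - B₀ i j)) / 4 := by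
    have hne' : A ≠ B₀ := fun h => hAC (h ▸ hB₀)
    obtain ⟨i, j, hij⟩ : ∃ i j, A i j ≠ B₀ i j := by
      by_contra! h
      exact hne' (Matrix.ext h)
    refine div_pos ?_ (by norm_num)
    refine Finset.sum_pos' (fun i _ => Finset.sum_nonneg fun j _ => Complex.normSq_nonneg _)
      ⟨i, Finset.mem_univ _, Finset.sum_pos' (fun j _ => Complex.normSq_nonneg _)
        ⟨j, Finset.mem_univ _, Complex.normSq_pos.2 (sub_ne_zero.2 hij)⟩⟩
  refine lt_of_lt_of_le (EReal.coe_pos.2 hpos) (le_iInf₂ fun B hB => ?_)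
  exact (EReal.coe_le_coe_iff.2 (hmin hB)).trans (relEntropy_ge_frobenius hA (hCs B hB))

end Spectral

/-! ### Positive semidefinite matrices and states -/

/-- An iterated form of the Schur product theorem, which covers tensor products of effects and of
states of blocks alike: these are Hadamard products of inflated factors. -/
lemma posSemidef_prod_submatrix {s m : Type} (S : Finset s) {n : s → Type}
    [∀ i, Fintype (n i)] [Fintype m] (f : ∀ i, m → n i) (M : ∀ i, Matrix (n i) (n i) ℂ)
    (hM : ∀ i ∈ S, (M i).PosSemidef) :
    (Matrix.of fun r c => ∏ i ∈ S, M i (f i r) (f i c)).PosSemidef := by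
  classical
  induction S using Finset.induction_on with
  | empty =>
    simpa [Matrix.vecMulVec, Matrix.of] using
      Matrix.posSemidef_vecMulVec_self_star (R := ℂ) (fun _ : m => (1 : ℂ))
  | insert a S ha ih =>
    simp only [Finset.prod_insert ha]
    exact ((hM a (Finset.mem_insert_self a S)).submatrix (f a)).hadamard
      (ih fun i hi => hM i (Finset.mem_insert_of_mem hi))

open scoped MatrixOrder Matrix.Norms.L2Operator in
lemma trace_mul_nonneg {n : Type} [Fintype n] {A B : Matrix n n ℂ} (hA : A.PosSemidef)
    (hB : B.PosSemidef) : 0 ≤ (A * B).trace := by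
  classical
  obtain ⟨C, rfl⟩ := CStarAlgebra.nonneg_iff_eq_star_mul_self.1 hB.nonneg
  rw [← mul_assoc, Matrix.trace_mul_comm, ← mul_assoc]
  exact (hA.mul_mul_conjTranspose_same C).trace_nonneg

/-- The determinant of a principal `2 × 2` submatrix is nonnegative. -/
lemma normSq_apply_le {n : Type} [Fintype n] {A : Matrix n n ℂ} (hA : A.PosSemidef) (i j : n) :
    Complex.normSq (A i j) ≤ (A i i).re * (A j j).re := by
  have h := (hA.submatrix ![i, j]).det_nonneg
  rw [Matrix.det_fin_two] at h
  simp only [Matrix.submatrix_apply, Matrix.cons_val_zero, Matrix.cons_val_one] at h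
  have hi := Complex.nonneg_iff.1 (hA.diag_nonneg (i := i))
  have hj := Complex.nonneg_iff.1 (hA.diag_nonneg (i := j))
  have h' := (Complex.nonneg_iff.1 h).1
  rw [← hA.1.apply j i, Complex.star_def, Complex.mul_conj] at h'
  simp only [Complex.sub_re, Complex.mul_re, ← hi.2, Complex.ofReal_re] at h'
  linarith

lemma IsState.normSq_apply_le_one {n : Type} [Fintype n] {A : Matrix n n ℂ} (hA : IsState A)
    (i j : n) : Complex.normSq (A i j) ≤ 1 := by
  have hd : ∀ i, 0 ≤ (A i i).re := fun i => (Complex.nonneg_iff.1 hA.1.diag_nonneg).1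
  have hle : ∀ i, (A i i).re ≤ 1 := by
    intro i
    have ht : ∑ i, (A i i).re = 1 := by
      simpa [Matrix.trace] using congrArg Complex.re hA.2
    rw [← ht]
    exact Finset.single_le_sum (f := fun i => (A i i).re) (fun j _ => hd j) (Finset.mem_univ i)
  exact (normSq_apply_le hA.1 i j).trans (mul_le_one₀ (hle i) (hd j) (hle j))

lemma isClosed_setOf_isState (n : Type) [Fintype n] : IsClosed {A : Matrix n n ℂ | IsState A} := by
  have h : {A : Matrix n n ℂ | IsState A} =
      ({A | A.conjTranspose = A} ∩ ⋂ x : n → ℂ, {A | 0 ≤ star x ⬝ᵥ A.mulVec x}) ∩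
        {A | A.trace = 1} := by
    ext A
    simp [IsState, Matrix.posSemidef_iff_dotProduct_mulVec, Matrix.IsHermitian]
  rw [h]
  refine (IsClosed.inter (isClosed_eq (by fun_prop) continuous_id) ?_).inter
    (isClosed_eq (by fun_prop) continuous_const)
  exact isClosed_iInter fun x => isClosed_le continuous_const (by fun_prop)

lemma isCompact_setOf_isState (n : Type) [Fintype n] :
    IsCompact {A : Matrix n n ℂ | IsState A} := by
  have hc : IsCompact (Set.pi Set.univ fun _ : n =>
      Set.pi Set.univ fun _ : n => Metric.closedBall (0 : ℂ) 1) :=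
    isCompact_univ_pi fun _ => isCompact_univ_pi fun _ => isCompact_closedBall _ _
  refine IsCompact.of_isClosed_subset (X := n → n → ℂ) hc (isClosed_setOf_isState n) ?_
  intro A hA i _ j _
  have h := IsState.normSq_apply_le_one hA i j
  rw [Complex.normSq_eq_norm_sq] at h
  rw [mem_closedBall_zero_iff]
  exact (sq_le_one_iff₀ (norm_nonneg _)).1 h

/-- In finite dimension, Carathéodory's theorem presents the convex hull of `s` as a continuous
image of the product of a standard simplex and a power of `s`. -/
lemma isCompact_convexHull {E : Type*} [AddCommGroup E] [Module ℝ E] [FiniteDimensional ℝ E]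
    [TopologicalSpace E] [ContinuousAdd E] [ContinuousSMul ℝ E] {s : Set E} (hs : IsCompact s) :
    IsCompact (convexHull ℝ s) := by
  let K := Fin (Module.finrank ℝ E + 1)
  have h : convexHull ℝ s = (fun x : (K → ℝ) × (K → E) => ∑ k, x.1 k • x.2 k) ''
      (stdSimplex ℝ K ×ˢ Set.pi Set.univ fun _ => s) := by
    refine Set.Subset.antisymm (fun x hx => ?_) ?_
    · obtain ⟨ι, _, z, w, hz, hind, hw, hw1, hx⟩ := eq_pos_convex_span_of_mem_convexHull hx
      obtain ⟨e⟩ : Nonempty (ι ↪ K) := by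
        rw [Function.Embedding.nonempty_iff_card_le, Fintype.card_fin]
        exact hind.card_le_finrank_succ.trans
          (Nat.succ_le_succ (Submodule.finrank_le _))
      obtain ⟨i₀⟩ : Nonempty ι := by
        by_contra hne
        rw [not_nonempty_iff] at hne
        simp at hw1
      have hout : ∀ k ∉ Set.range e, Function.extend e w 0 k = 0 := fun k hk =>
        Function.extend_apply' _ _ _ hk
      refine ⟨(Function.extend e w 0, Function.extend e z fun _ => z i₀),
        ⟨⟨fun k => ?_, ?_⟩, ?_⟩, ?_⟩
      · by_cases hk : k ∈ Set.range e
        · obtain ⟨i, rfl⟩ := hk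
          simp only [e.injective.extend_apply]
          exact (hw i).le
        · exact (hout k hk).ge
      · rw [← hw1]
        exact (Fintype.sum_of_injective e e.injective _ _ hout
          fun i => (e.injective.extend_apply _ _ i).symm).symm
      · intro k _
        by_cases hk : k ∈ Set.range e
        · obtain ⟨i, rfl⟩ := hk
          simp only [e.injective.extend_apply]
          exact hz ⟨i, rfl⟩
        · simp only [Function.extend_apply' _ _ _ hk]
          exact hz ⟨i₀, rfl⟩
      · rw [← hx]
        refine (Fintype.sum_of_injective e e.injective _ _ (fun k hk => ?_) fun i => ?_).symm
        · simp only [hout k hk, zero_smul]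
        · simp only [e.injective.extend_apply]
    · rintro _ ⟨⟨w, z⟩, ⟨hw, hz⟩, rfl⟩
      exact mem_convexHull_of_exists_fintype w z hw.1 hw.2 (fun k => hz k (Set.mem_univ k)) rfl
  rw [h]
  exact ((isCompact_stdSimplex ℝ K).prod (isCompact_univ_pi fun _ => hs)).image (by fun_prop)

lemma isState_ketbra {n : Type} [Fintype n] (v : EuclideanSpace ℂ n) (hv : ‖v‖ = 1) :
    IsState (ketbra v) := by
  refine ⟨Matrix.posSemidef_vecMulVec_self_star (R := ℂ) (fun i => v i), ?_⟩
  have h : ((∑ i, ‖v i‖ ^ 2 : ℝ) : ℂ) = 1 := by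
    rw [← EuclideanSpace.norm_sq_eq, hv]
    simp
  rw [← h]
  push_cast
  refine Finset.sum_congr rfl fun i _ => ?_
  rw [Matrix.diag_apply, ketbra, Complex.star_def, Complex.mul_conj, Complex.normSq_eq_norm_sq]
  push_cast
  rfl

/-- The spectral decomposition in terms of the rank-one operators of an eigenbasis. -/
lemma sum_eigenvalues_smul_ketbra {n : Type} [Fintype n] [DecidableEq n] {A : Matrix n n ℂ}
    (hA : A.IsHermitian) :
    A = ∑ a, (hA.eigenvalues a : ℂ) • ketbra (hA.eigenvectorBasis a) := by
  ext i j
  conv_lhs => rw [hA.spectral_theorem, Unitary.conjStarAlgAut_apply]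
  rw [Matrix.mul_apply, Matrix.sum_apply]
  refine Finset.sum_congr rfl fun a _ => ?_
  rw [Matrix.mul_diagonal, Matrix.star_apply, Matrix.smul_apply, ketbra, smul_eq_mul]
  simp only [hA.eigenvectorUnitary_apply, Function.comp_apply, Complex.coe_algebraMap]
  ring

/-! ### Tensor products over the blocks of a partition -/

section Blocks

variable {N d : ℕ} (P : Finpartition (Finset.univ : Finset (Fin N)))

/-- A configuration of all parties amounts to one of every block. -/
def configEquiv (d : ℕ) : (Fin N → Fin d) ≃ ∀ B : P.parts, (B.1 → Fin d) :=
  (Equiv.arrowCongr ((Equiv.subtypeUnivEquiv fun i => Finset.mem_univ i).symm.trans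
    P.equivSigmaParts) (Equiv.refl _)).trans (Equiv.piCurry fun _ _ => Fin d)

lemma sum_prod_blocks (f : ∀ B : P.parts, (B.1 → Fin d) → ℂ) :
    ∑ r : Fin N → Fin d, ∏ B : P.parts, f B (fun i : B.1 => r i) = ∏ B, ∑ a, f B a := by
  rw [Finset.prod_univ_sum, Fintype.piFinset_univ]
  exact Fintype.sum_equiv (configEquiv P d) _ _ fun r => rfl

lemma trace_blockTensor (σ : ∀ B : P.parts, Op B.1 d) :
    (blockTensor P σ).trace = ∏ B, (σ B).trace :=
  sum_prod_blocks P fun B a => σ B a a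

lemma isState_blockTensor {σ : ∀ B : P.parts, Op B.1 d} (hσ : ∀ B, IsState (σ B)) :
    IsState (blockTensor P σ) := by
  refine ⟨posSemidef_prod_submatrix (m := Fin N → Fin d) Finset.univ
    (fun (B : P.parts) r (i : B.1) => r i) σ fun B _ => (hσ B).1, ?_⟩
  rw [trace_blockTensor]
  exact Finset.prod_eq_one fun B _ => (hσ B).2

lemma continuous_blockTensor :
    Continuous (blockTensor P : (∀ B : P.parts, Op B.1 d) → Op (Fin N) d) := by
  refine continuous_matrix fun r c => ?_
  refine continuous_finsetProd _ fun B _ => ?_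
  exact (continuous_apply B).matrix_elem _ _

lemma isState_of_mem_productStates {k : ℕ} {ρ : Op (Fin N) d} (h : ρ ∈ productStates N d k) :
    IsState ρ := by
  obtain ⟨P, σ, -, hσ, rfl⟩ := h
  exact isState_blockTensor P hσ

lemma isCompact_productStates (N d k : ℕ) : IsCompact (productStates N d k) := by
  have h : productStates N d k = ⋃ P ∈ {P : Finpartition (Finset.univ : Finset (Fin N)) |
      ∀ B ∈ P.parts, B.card ≤ k},
        blockTensor P '' Set.pi Set.univ fun B : P.parts => {A : Op B.1 d | IsState A} := by
    ext ρ
    simp only [productStates, Set.mem_ofPred_eq, Set.mem_iUnion, Set.mem_image, Set.mem_pi,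
      Set.mem_univ, true_imp_iff, exists_prop]
    constructor
    · rintro ⟨P, σ, hP, hσ, rfl⟩
      exact ⟨P, hP, σ, hσ, rfl⟩
    · rintro ⟨P, hP, σ, hσ, rfl⟩
      exact ⟨P, σ, hP, hσ, rfl⟩
  rw [h]
  exact (Set.toFinite _).isCompact_biUnion fun P _ =>
    (isCompact_univ_pi fun B => isCompact_setOf_isState _).image (continuous_blockTensor P)

lemma convex_setOf_isState (n : Type) [Fintype n] : Convex ℝ {A : Matrix n n ℂ | IsState A} := by
  intro A hA B hB a b ha hb hab
  refine ⟨(hA.1.smul ha).add (hB.1.smul hb), ?_⟩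
  rw [Matrix.trace_add, Matrix.trace_smul, Matrix.trace_smul, hA.2, hB.2, ← add_smul, hab, one_smul]

lemma isState_of_mem_separableStates {k : ℕ} {ρ : Op (Fin N) d} (h : ρ ∈ separableStates N d k) :
    IsState ρ :=
  convexHull_min (fun _ h => isState_of_mem_productStates h) (convex_setOf_isState _) h

lemma isCompact_separableStates (N d k : ℕ) : IsCompact (separableStates N d k) :=
  isCompact_convexHull (isCompact_productStates N d k)

/-- The product of eigenbases of the factors diagonalizes a product state. -/
lemma productStates_subset_classicalStates (N d k : ℕ) :
    productStates N d k ⊆ classicalStates N d k := by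
  rintro _ ⟨P, σ, hP, hσ, rfl⟩
  refine ⟨P, fun B => (hσ B).1.1.eigenvectorBasis,
    fun α => ∏ B, (hσ B).1.1.eigenvalues (α B), hP,
    fun α => Finset.prod_nonneg fun B _ => (hσ B).eigenvalues_nonneg _, ?_, ?_⟩
  · rw [← Fintype.piFinset_univ, ← Finset.prod_univ_sum]
    exact Finset.prod_eq_one fun B _ => (hσ B).sum_eigenvalues
  · ext r c
    simp only [Matrix.sum_apply, Matrix.smul_apply, blockTensor]
    have h : ∀ B : P.parts, σ B (fun i : B.1 => r i) (fun i : B.1 => c i) =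
        ∑ a, ((hσ B).1.1.eigenvalues a : ℂ) *
          ketbra ((hσ B).1.1.eigenvectorBasis a) (fun i : B.1 => r i) (fun i : B.1 => c i) := by
      intro B
      conv_lhs => rw [sum_eigenvalues_smul_ketbra (hσ B).1.1]
      rw [Matrix.sum_apply]
      rfl
    simp only [h]
    rw [Finset.prod_univ_sum, Fintype.piFinset_univ]
    refine Finset.sum_congr rfl fun α _ => ?_
    rw [Finset.prod_mul_distrib, Complex.real_smul]
    push_cast
    rfl

lemma classicalStates_subset_separableStates (N d k : ℕ) :
    classicalStates N d k ⊆ separableStates N d k := by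
  rintro _ ⟨P, b, p, hP, hp, hp1, rfl⟩
  refine mem_convexHull_of_exists_fintype p _ hp hp1 (fun α => ?_) rfl
  exact ⟨P, _, hP, fun B => isState_ketbra _ ((b B).norm_eq_one _), rfl⟩

end Blocks

lemma mem_GMT_iff {N d : ℕ} {ρ : Op (Fin N) d} (hρ : IsState ρ) :
    ρ ∈ GMT N d ↔ ρ ∉ productStates N d (N - 1) :=
  ⟨fun h hm => (entropyDist_le_zero hm).not_gt h.2, fun h => ⟨hρ, entropyDist_pos
    (isCompact_productStates N d _) (fun _ => isState_of_mem_productStates) hρ h⟩⟩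

lemma mem_GME_iff {N d : ℕ} {ρ : Op (Fin N) d} (hρ : IsState ρ) :
    ρ ∈ GME N d ↔ ρ ∉ separableStates N d (N - 1) :=
  ⟨fun h hm => (entropyDist_le_zero hm).not_gt h.2, fun h => ⟨hρ, entropyDist_pos
    (isCompact_separableStates N d _) (fun _ => isState_of_mem_separableStates) hρ h⟩⟩

lemma GMD_subset_GMT (N d : ℕ) : GMD N d ⊆ GMT N d := fun _ h =>
  ⟨h.1, h.2.trans_le (entropyDist_anti (productStates_subset_classicalStates N d _))⟩

lemma GME_subset_GMD (N d : ℕ) : GME N d ⊆ GMD N d := fun _ h =>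
  ⟨h.1, h.2.trans_le (entropyDist_anti (classicalStates_subset_separableStates N d _))⟩

/-! ### Local measurements -/

section Born

variable {ι : Type} [Fintype ι] [DecidableEq ι] {d : ℕ}

lemma posSemidef_jointEffect (x : ι → Measurement d) (a : Outcome x) :
    (jointEffect x a).PosSemidef :=
  posSemidef_prod_submatrix (m := ι → Fin d) Finset.univ (fun i r => r i)
    (fun i => (x i).effect (a i)) fun i _ => (x i).posSemidef (a i)

lemma sum_jointEffect (x : ι → Measurement d) :
    ∑ a, jointEffect x a = 1 := by
  ext r c
  have h : ∀ i, ∑ a, (x i).effect a (r i) (c i) = if r i = c i then 1 else 0 := fun i => by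
    rw [← Matrix.sum_apply, (x i).sum_effect, Matrix.one_apply]
  simp only [Matrix.sum_apply, jointEffect]
  rw [← Fintype.piFinset_univ, ← Finset.prod_univ_sum (fun i => Finset.univ)
    (fun i a => (x i).effect a (r i) (c i))]
  simp only [h, Matrix.one_apply]
  rw [Finset.prod_ite_zero]
  simp [funext_iff]

lemma ofReal_born {ρ : Op ι d} (hρ : ρ.PosSemidef) (x : ι → Measurement d) (a : Outcome x) :
    (born ρ x a : ℂ) = (ρ * jointEffect x a).trace :=
  Complex.ext rfl (Complex.nonneg_iff.1 (trace_mul_nonneg hρ (posSemidef_jointEffect x a))).2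

lemma born_nonneg {ρ : Op ι d} (hρ : ρ.PosSemidef) (x : ι → Measurement d) (a : Outcome x) :
    0 ≤ born ρ x a :=
  (Complex.nonneg_iff.1 (trace_mul_nonneg hρ (posSemidef_jointEffect x a))).1

lemma sum_born {ρ : Op ι d} (hρ : IsState ρ) (x : ι → Measurement d) : ∑ a, born ρ x a = 1 := by
  simp only [born]
  rw [← Complex.re_sum, ← Matrix.trace_sum, ← Finset.mul_sum, sum_jointEffect, mul_one, hρ.2,
    Complex.one_re]

lemma born_sum_smul {K : Type} [Fintype K] (p : K → ℝ) (ρ : K → Op ι d) (x : ι → Measurement d)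
    (a : Outcome x) : born (∑ k, p k • ρ k) x a = ∑ k, p k * born (ρ k) x a := by
  simp only [born, Finset.sum_mul, Matrix.trace_sum, Complex.re_sum, smul_mul_assoc,
    Matrix.trace_smul, Complex.smul_re, smul_eq_mul]

lemma HiddenState.measurable_born {Λ : Type} [MeasurableSpace Λ] (H : HiddenState ι d Λ)
    (x : ι → Measurement d) (a : Outcome x) : Measurable fun l => born (H.state l) x a := by
  simp only [born, Matrix.trace, Matrix.diag_apply, Matrix.mul_apply]
  refine Complex.measurable_re.comp ?_
  exact Finset.measurable_fun_sum _ fun r _ => Finset.measurable_fun_sum _ fun c _ =>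
    (H.measurable r c).mul_const _

/-- The response obtained by measuring a hidden state. -/
noncomputable def HiddenState.toResponse {Λ : Type} [MeasurableSpace Λ] (H : HiddenState ι d Λ) :
    Response ι d Λ where
  prob x a l := born (H.state l) x a
  measurable := H.measurable_born
  nonneg x a l := born_nonneg (H.isState l).1 x a
  sum_eq_one x l := sum_born (H.isState l) x

end Born

lemma HybridLHS.hybridLHV {N d : ℕ} {ρ : Op (Fin N) d} (h : HybridLHS ρ) : HybridLHV ρ := by
  obtain ⟨w, M, hw, hw1, hM⟩ := h
  exact ⟨w, fun A => ⟨(M A).Λ, (M A).μ, (M A).isProb, (M A).left, (M A).right.toResponse⟩,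
    hw, hw1, hM⟩

lemma GMNL_subset_GMS (N d : ℕ) : GMNL N d ⊆ GMS N d := fun _ h =>
  ⟨h.1, fun hLHS => h.2 hLHS.hybridLHV⟩

/-! ### Products across a bipartition -/

section Bipartite

variable {N d : ℕ} (A : Finset (Fin N))

/-- The tensor product of an operator of the parties in `A` and one of the other parties. -/
def tensor (σ : Op A d) (τ : Op (Aᶜ : Finset (Fin N)) d) : Op (Fin N) d := fun r c =>
  σ (fun i => r i) (fun i => c i) * τ (fun i => r i) (fun i => c i)

/-- A configuration of all parties amounts to one of `A` and one of `Aᶜ`. -/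
def splitEquiv (d : ℕ) :
    (Fin N → Fin d) ≃ (A → Fin d) × ((Aᶜ : Finset (Fin N)) → Fin d) where
  toFun r := (fun i => r i, fun i => r i)
  invFun p i := if h : i ∈ A then p.1 ⟨i, h⟩ else p.2 ⟨i, Finset.mem_compl.2 h⟩
  left_inv r := by ext i; simp
  right_inv p := by
    ext i
    · simp
    · simp [Finset.mem_compl.1 i.2]

variable {A}

lemma sum_split (f : (A → Fin d) → ℂ) (g : ((Aᶜ : Finset (Fin N)) → Fin d) → ℂ) :
    ∑ r : Fin N → Fin d, f (fun i => r i) * g (fun i => r i) = (∑ r, f r) * ∑ r, g r := by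
  rw [Finset.sum_mul_sum, ← Fintype.sum_prod_type']
  exact Fintype.sum_equiv (splitEquiv A d) _ _ fun r => rfl

lemma trace_tensor (σ : Op A d) (τ : Op (Aᶜ : Finset (Fin N)) d) :
    (tensor A σ τ).trace = σ.trace * τ.trace :=
  sum_split (fun r => σ r r) fun r => τ r r

lemma jointEffect_eq_tensor (x : Fin N → Measurement d) (a : Outcome x) :
    jointEffect x a = tensor A (jointEffect (fun i : A => x i) fun i => a i)
      (jointEffect (fun i : (Aᶜ : Finset (Fin N)) => x i) fun i => a i) := by
  ext r c
  simp only [jointEffect, tensor]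
  rw [Finset.prod_coe_sort A fun i => (x i).effect (a i) (r i) (c i),
    Finset.prod_coe_sort Aᶜ fun i => (x i).effect (a i) (r i) (c i), Finset.prod_mul_prod_compl]

lemma tensor_mul_tensor (σ σ' : Op A d) (τ τ' : Op (Aᶜ : Finset (Fin N)) d) :
    tensor A σ τ * tensor A σ' τ' = tensor A (σ * σ') (τ * τ') := by
  ext r c
  simp only [Matrix.mul_apply, tensor]
  rw [← sum_split]
  exact Finset.sum_congr rfl fun _ _ => by ring

lemma born_tensor {σ : Op A d} {τ : Op (Aᶜ : Finset (Fin N)) d} (hσ : σ.PosSemidef)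
    (hτ : τ.PosSemidef) (x : Fin N → Measurement d) (a : Outcome x) :
    born (tensor A σ τ) x a =
      born σ (fun i => x i) (fun i => a i) * born τ (fun i => x i) (fun i => a i) := by
  rw [born, jointEffect_eq_tensor, tensor_mul_tensor, trace_tensor, ← ofReal_born hσ,
    ← ofReal_born hτ, ← Complex.ofReal_mul, Complex.ofReal_re]

end Bipartite

lemma pos_dim_of_isState {N d : ℕ} (hN : 0 < N) {ρ : Op (Fin N) d} (hρ : IsState ρ) : 0 < d := by
  rcases Nat.eq_zero_or_pos d with rfl | hd
  · have : IsEmpty (Fin N → Fin 0) := ⟨fun r => (r ⟨0, hN⟩).elim0⟩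
    simpa [Matrix.trace] using hρ.2
  · exact hd

/-- Every product state is a product across a bipartition, one side of which is a block of the
given partition. -/
lemma exists_tensor_of_mem_productStates {N d : ℕ} (hN : 0 < N) {ρ : Op (Fin N) d}
    (h : ρ ∈ productStates N d (N - 1)) :
    ∃ (A : Bipartition N) (σ : Op A.1 d) (τ : Op (A.1ᶜ : Finset (Fin N)) d),
      IsState σ ∧ IsState τ ∧ ρ = tensor A.1 σ τ := by
  have hρ := isState_of_mem_productStates h
  have hd := pos_dim_of_isState hN hρ
  obtain ⟨P, σ, hP, hσ, rfl⟩ := h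
  let B₀ : P.parts := ⟨P.part ⟨0, hN⟩, P.part_mem.2 (Finset.mem_univ _)⟩
  have hne : (B₀.1 : Finset (Fin N))ᶜ.Nonempty := by
    rw [← Finset.card_pos, Finset.card_compl, Fintype.card_fin]
    have := hP B₀.1 B₀.2
    omega
  -- configurations of the other parties are padded by a constant on the chosen block
  let ext (r : (B₀.1ᶜ : Finset (Fin N)) → Fin d) (i : Fin N) : Fin d :=
    if h : i ∈ B₀.1ᶜ then r ⟨i, h⟩ else ⟨0, hd⟩
  let τ : Op (B₀.1ᶜ : Finset (Fin N)) d := Matrix.of fun r c =>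
    ∏ B ∈ Finset.univ.erase B₀, σ B (fun i : B.1 => ext r i) (fun i : B.1 => ext c i)
  have hτ : τ.PosSemidef := posSemidef_prod_submatrix (m := (B₀.1ᶜ : Finset (Fin N)) → Fin d)
    (Finset.univ.erase B₀) (fun (B : P.parts) r (i : B.1) => ext r i) σ fun B _ => (hσ B).1
  have heq : blockTensor P σ = tensor B₀.1 (σ B₀) τ := by
    ext r c
    rw [blockTensor, ← Finset.mul_prod_erase _ _ (Finset.mem_univ B₀)]
    refine congrArg _ (Finset.prod_congr rfl fun B hB => ?_)
    have hext : ∀ r : Fin N → Fin d,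
        (fun i : B.1 => ext (fun j => r j) i) = fun i : B.1 => r i := by
      intro r
      funext i
      have hi : (i : Fin N) ∈ B₀.1ᶜ := Finset.mem_compl.2 fun hi₀ =>
        Finset.disjoint_left.1 (P.disjoint B.2 B₀.2 fun h => (Finset.mem_erase.1 hB).1
          (Subtype.ext h)) i.2 hi₀
      simp only [ext, dif_pos hi]
    rw [hext, hext]
  refine ⟨⟨B₀.1, P.nonempty_of_mem_parts B₀.2, hne⟩, σ B₀, τ, hσ B₀, ⟨hτ, ?_⟩, heq⟩
  have h := hρ.2
  rwa [heq, trace_tensor, (hσ B₀).2, one_mul] at h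

/-! ### Hidden state models with finitely many hidden states -/

/-- The local hidden state model given by a probability mass function on a finite set of hidden
states and by an arbitrary response to each of them. -/
noncomputable def LHSModel.discrete {N d : ℕ} {A : Finset (Fin N)} {K : Type} (m : PMF K)
    (p : K → ∀ x : A → Measurement d, Outcome x → ℝ) (hp : ∀ k x a, 0 ≤ p k x a)
    (hp1 : ∀ k x, ∑ a, p k x a = 1) (τ : K → Op (Aᶜ : Finset (Fin N)) d)
    (hτ : ∀ k, IsState (τ k)) : LHSModel N d A where
  Λ := K
  measurableSpace := ⊤
  μ := @PMF.toMeasure K ⊤ m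
  isProb := @PMF.toMeasure.isProbabilityMeasure K ⊤ m
  left :=
    letI : MeasurableSpace K := ⊤
    { prob := fun x a k => p k x a
      measurable := fun _ _ => measurable_from_top
      nonneg := fun x a k => hp k x a
      sum_eq_one := fun x k => hp1 k x }
  right :=
    letI : MeasurableSpace K := ⊤
    { state := τ
      measurable := fun _ _ => measurable_from_top
      isState := hτ }

lemma LHSModel.prob_discrete {N d : ℕ} {A : Finset (Fin N)} {K : Type} [Fintype K] (m : PMF K)
    (p : K → ∀ x : A → Measurement d, Outcome x → ℝ) (hp : ∀ k x a, 0 ≤ p k x a)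
    (hp1 : ∀ k x, ∑ a, p k x a = 1) (τ : K → Op (Aᶜ : Finset (Fin N)) d)
    (hτ : ∀ k, IsState (τ k)) (x : Fin N → Measurement d) (a : Outcome x) :
    (LHSModel.discrete m p hp hp1 τ hτ).prob x a = ∑ k, (m k).toReal *
      (p k (fun i => x i) (fun i => a i) * born (τ k) (fun i => x i) (fun i => a i)) := by
  let : MeasurableSpace K := ⊤
  exact PMF.integral_eq_sum m _

/-- Nonnegative weights are a multiple of a probability mass function (any one, if they
vanish). -/
lemma exists_pmf_of_nonneg {K : Type} [Fintype K] [Nonempty K] (q : K → ℝ) (hq : ∀ k, 0 ≤ q k) :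
    ∃ m : PMF K, ∀ k, q k = (∑ j, q j) * (m k).toReal := by
  rcases (Finset.sum_nonneg fun k _ => hq k : 0 ≤ ∑ j, q j).eq_or_lt with h | h
  · refine ⟨PMF.pure (Classical.arbitrary K), fun k => ?_⟩
    rw [← h, zero_mul]
    exact (Finset.sum_eq_zero_iff_of_nonneg fun k _ => hq k).1 h.symm k (Finset.mem_univ k)
  · refine ⟨PMF.ofFintype (fun k => ENNReal.ofReal (q k / ∑ j, q j)) ?_, fun k => ?_⟩
    · rw [← ENNReal.ofReal_sum_of_nonneg fun k _ => div_nonneg (hq k) h.le, ← Finset.sum_div,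
        div_self h.ne', ENNReal.ofReal_one]
    · rw [PMF.ofFintype_apply, ENNReal.toReal_ofReal (div_nonneg (hq k) h.le)]
      field_simp

lemma exists_isState {n : Type} [Fintype n] [DecidableEq n] [Nonempty n] :
    ∃ A : Matrix n n ℂ, IsState A :=
  ⟨_, isState_ketbra (EuclideanSpace.single (Classical.arbitrary n) 1) (by simp)⟩

/-- The hidden variable is the term of the decomposition; given the bipartition, both sides measure
their own factor of that term. -/
theorem hybridLHS_of_mem_separableStates {N d : ℕ} (hN : 0 < N) {ρ : Op (Fin N) d}
    (h : ρ ∈ separableStates N d (N - 1)) : HybridLHS ρ := by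
  classical
  have hd := pos_dim_of_isState hN (isState_of_mem_separableStates h)
  have : Nonempty (Fin d) := ⟨⟨0, hd⟩⟩
  obtain ⟨K, _, p, ρs, hp, hp1, hρs, rfl⟩ := mem_convexHull_iff_exists_fintype.1 h
  have : Nonempty K := by
    by_contra hK
    rw [not_nonempty_iff] at hK
    simp at hp1
  have hdec : ∀ k, ∃ (A₀ : Bipartition N) (σ : ∀ A : Bipartition N, Op A.1 d)
      (τ : ∀ A : Bipartition N, Op (A.1ᶜ : Finset (Fin N)) d),
      (∀ A, IsState (σ A)) ∧ (∀ A, IsState (τ A)) ∧ ρs k = tensor A₀.1 (σ A₀) (τ A₀) := by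
    intro k
    obtain ⟨A₀, σ, τ, hσ, hτ, hk⟩ := exists_tensor_of_mem_productStates hN (hρs k)
    choose σ' hσ' using fun A : Bipartition N => exists_isState (n := A.1 → Fin d)
    choose τ' hτ' using fun A : Bipartition N =>
      exists_isState (n := (A.1ᶜ : Finset (Fin N)) → Fin d)
    refine ⟨A₀, Function.update σ' A₀ σ, Function.update τ' A₀ τ, fun A => ?_, fun A => ?_, ?_⟩
    · rcases eq_or_ne A A₀ with rfl | hA
      · simpa using hσ
      · simpa [hA] using hσ' A
    · rcases eq_or_ne A A₀ with rfl | hA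
      · simpa using hτ
      · simpa [hA] using hτ' A
    · simpa using hk
  choose A₀ σ τ hσ hτ hk using hdec
  choose m hm using fun A : Bipartition N =>
    exists_pmf_of_nonneg (fun k => if A₀ k = A then p k else 0)
      fun k => by split_ifs; exacts [hp k, le_rfl]
  refine ⟨fun A => ∑ k, if A₀ k = A then p k else 0, fun A => LHSModel.discrete (m A)
    (fun k x a => born (σ k A) x a) (fun k x a => born_nonneg (hσ k A).1 x a)
    (fun k x => sum_born (hσ k A) x) (fun k => τ k A) (fun k => hτ k A), fun A => ?_, ?_, ?_⟩
  · exact Finset.sum_nonneg fun k _ => by split_ifs; exacts [hp k, le_rfl]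
  · rw [Finset.sum_comm]
    simpa using hp1
  · intro x a
    simp only [LHSModel.prob_discrete, Finset.mul_sum, ← mul_assoc (∑ _, _), ← hm]
    rw [Finset.sum_comm, born_sum_smul]
    refine Finset.sum_congr rfl fun k _ => ?_
    rw [Finset.sum_eq_single (A₀ k) (fun A _ hA => by rw [if_neg hA.symm, zero_mul])
      (fun h => absurd (Finset.mem_univ _) h), if_pos rfl, hk k,
      born_tensor (hσ k _).1 (hτ k _).1]

theorem GMS_subset_GME {N : ℕ} (d : ℕ) (hN : 0 < N) : GMS N d ⊆ GME N d := fun _ h =>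
  (mem_GME_iff h.1).2 fun hs => h.2 (hybridLHS_of_mem_separableStates hN hs)

/-! ### Computational basis states and a correlated mixture of them -/

lemma isState_single {n : Type} [Fintype n] [DecidableEq n] (r : n) :
    IsState (Matrix.single r r (1 : ℂ)) := by
  have h : Matrix.single r r (1 : ℂ) = ketbra (EuclideanSpace.single r 1) := by
    ext i j
    simp only [ketbra, Matrix.single_apply, PiLp.single_apply, ite_and, eq_comm (a := r)]
    split_ifs <;> simp
  rw [h]
  exact isState_ketbra _ (by simp)

lemma single_mem_productStates {N d k : ℕ} (hk : 1 ≤ k) (r : Fin N → Fin d) :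
    Matrix.single r r (1 : ℂ) ∈ productStates N d k := by
  refine ⟨⊥, fun B => Matrix.single (fun i => r i) (fun i => r i) 1, fun B hB => ?_,
    fun B => isState_single _, ?_⟩
  · obtain ⟨i, -, rfl⟩ := Finpartition.mem_bot_iff.1 hB
    simpa using hk
  · ext s t
    simp only [blockTensor, Matrix.single_apply]
    rw [Finset.prod_ite_zero]
    simp only [Finset.prod_const_one]
    refine if_congr ⟨?_, fun h => ?_⟩ rfl rfl
    · rintro ⟨rfl, rfl⟩ B -
      exact ⟨rfl, rfl⟩
    · refine ⟨funext fun i => ?_, funext fun i => ?_⟩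
      · exact congr_fun (h ⟨{i}, Finpartition.mem_bot_iff.2 ⟨i, Finset.mem_univ i, rfl⟩⟩
          (Finset.mem_univ _)).1 ⟨i, Finset.mem_singleton_self i⟩
      · exact congr_fun (h ⟨{i}, Finpartition.mem_bot_iff.2 ⟨i, Finset.mem_univ i, rfl⟩⟩
          (Finset.mem_univ _)).2 ⟨i, Finset.mem_singleton_self i⟩

/-- The configuration with value `a` on `A` and `b` off `A`. -/
def twoValued {N d : ℕ} (A : Finset (Fin N)) (a b : Fin d) (i : Fin N) : Fin d :=
  if i ∈ A then a else b

section TwoValued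

variable {N d : ℕ} {A : Finset (Fin N)}

lemma twoValued_restrict (a b : Fin d) : (fun i : A => twoValued A a b i) = fun _ => a :=
  funext fun i => if_pos i.2

lemma twoValued_restrict_compl (a b : Fin d) :
    (fun i : (Aᶜ : Finset (Fin N)) => twoValued A a b i) = fun _ => b :=
  funext fun i => if_neg (Finset.mem_compl.1 i.2)

lemma twoValued_self (a : Fin d) : twoValued A a a = fun _ => a :=
  funext fun _ => ite_self _

lemma twoValued_injective (hA : A.Nonempty) (hAc : Aᶜ.Nonempty) {a b a' b' : Fin d}
    (h : twoValued A a b = twoValued A a' b') : a = a' ∧ b = b' := by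
  obtain ⟨i, hi⟩ := hA
  obtain ⟨j, hj⟩ := hAc
  have h1 := congr_fun h i
  have h2 := congr_fun h j
  simp only [twoValued, hi, Finset.mem_compl.1 hj, if_true, if_false] at h1 h2
  exact ⟨h1, h2⟩

lemma twoValued_ne_const (hA : A.Nonempty) (hAc : Aᶜ.Nonempty) {a b : Fin d} (hab : a ≠ b)
    (c : Fin d) : twoValued A a b ≠ fun _ => c := by
  intro h
  rw [← twoValued_self (A := A)] at h
  obtain ⟨rfl, rfl⟩ := twoValued_injective hA hAc h
  exact hab rfl

lemma tensor_twoValued (σ : Op A d) (τ : Op (Aᶜ : Finset (Fin N)) d) (a b a' b' : Fin d) :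
    tensor A σ τ (twoValued A a b) (twoValued A a' b') =
      σ (fun _ => a) (fun _ => a') * τ (fun _ => b) (fun _ => b') := by
  simp only [tensor, twoValued_restrict, twoValued_restrict_compl]

end TwoValued

/-- The mixture `½|0…0⟩⟨0…0| + ½|1…1⟩⟨1…1|` is separable, but the entries of a product over
`A | Aᶜ` satisfy `ρ₀₀ ρ₁₁ = ρ₀₁ ρ₁₀` on the diagonal, where `ab` has `a` on `A` and `b` off `A`. -/
theorem GMT_sdiff_GME_nonempty {N d : ℕ} (hN : 2 ≤ N) (hd : 2 ≤ d) :
    ∃ ρ ∈ GMT N d, ρ ∉ GME N d := by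
  let z : Fin d := ⟨0, by omega⟩
  let o : Fin d := ⟨1, by omega⟩
  have hzo : z ≠ o := by simp [z, o]
  let c (a : Fin d) : Fin N → Fin d := fun _ => a
  have hc : c z ≠ c o := fun h => hzo (congr_fun h ⟨0, by omega⟩)
  let ρ : Op (Fin N) d := (1 / 2 : ℝ) • Matrix.single (c z) (c z) (1 : ℂ) +
    (1 / 2 : ℝ) • Matrix.single (c o) (c o) (1 : ℂ)
  have hsep : ρ ∈ separableStates N d (N - 1) := by
    refine convex_convexHull ℝ _ (subset_convexHull ℝ _ (single_mem_productStates (by omega) _))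
      (subset_convexHull ℝ _ (single_mem_productStates (by omega) _)) ?_ ?_ ?_ <;> norm_num
  have hρ := isState_of_mem_separableStates hsep
  refine ⟨ρ, (mem_GMT_iff hρ).2 fun hprod => ?_, fun h => (mem_GME_iff hρ).1 h hsep⟩
  obtain ⟨⟨A, hA, hAc⟩, σ, τ, -, -, heq⟩ := exists_tensor_of_mem_productStates (by omega) hprod
  have e := fun a b => (congr_fun (congr_fun heq (twoValued A a b)) (twoValued A a b)).trans
    (tensor_twoValued σ τ a b a b)
  have h00 := e z z
  have h11 := e o o
  have h01 := e z o
  simp only [twoValued_self] at h00 h11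
  simp only [ρ, Matrix.add_apply, Matrix.smul_apply, Matrix.single_apply] at h00 h11 h01
  rw [if_neg (fun h => twoValued_ne_const hA hAc hzo _ h.1.symm),
    if_neg (fun h => twoValued_ne_const hA hAc hzo _ h.1.symm)] at h01
  rw [if_pos ⟨rfl, rfl⟩, if_neg (fun h => hc h.1.symm)] at h00
  rw [if_neg (fun h => hc h.1), if_pos ⟨rfl, rfl⟩] at h11
  simp only [smul_zero, add_zero, zero_add] at h00 h11 h01
  rcases mul_eq_zero.1 h01.symm with h | h
  · rw [h] at h00; norm_num at h00
  · rw [h] at h11; norm_num at h11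

/-! ### A linear witness of genuine multipartite entanglement -/

section Witness

variable {N d : ℕ}

open Classical in
/-- Weights of the diagonal entries in `entanglementWitness`: the constant configurations `z…z` and
`o…o` do not count, and the others are weighted according to the value at the party `i`. -/
noncomputable def witnessWeight (i : Fin N) (z o : Fin d) (r : Fin N → Fin d) : ℝ :=
  if (r = fun _ => z) ∨ (r = fun _ => o) then 0 else if r i = z then 1 / 2 else 2

/-- A linear functional that is nonnegative on separable states: the weighted diagonal entries
dominate twice the coherence between `z…z` and `o…o`. -/
noncomputable def entanglementWitness (i : Fin N) (z o : Fin d) (ρ : Op (Fin N) d) : ℝ :=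
  ∑ r, witnessWeight i z o r * (ρ r r).re - 2 * (ρ (fun _ => z) (fun _ => o)).re

lemma witnessWeight_nonneg (i : Fin N) (z o : Fin d) (r : Fin N → Fin d) :
    0 ≤ witnessWeight i z o r := by
  unfold witnessWeight
  split_ifs <;> norm_num

lemma witnessWeight_twoValued {A : Finset (Fin N)} (hA : A.Nonempty) (hAc : Aᶜ.Nonempty)
    (i : Fin N) {z o a b : Fin d} (hab : a ≠ b) :
    witnessWeight i z o (twoValued A a b) = if twoValued A a b i = z then 1 / 2 else 2 :=
  if_neg fun h => h.elim (twoValued_ne_const hA hAc hab z) (twoValued_ne_const hA hAc hab o)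

lemma witnessWeight_mul_witnessWeight {A : Finset (Fin N)} (hA : A.Nonempty) (hAc : Aᶜ.Nonempty)
    (i : Fin N) {z o : Fin d} (hzo : z ≠ o) :
    witnessWeight i z o (twoValued A z o) * witnessWeight i z o (twoValued A o z) = 1 := by
  rw [witnessWeight_twoValued hA hAc i hzo, witnessWeight_twoValued hA hAc i hzo.symm]
  by_cases hi : i ∈ A <;> simp [twoValued, hi, hzo.symm]

/-- Positivity of both factors bounds the coherence of a product over `A | Aᶜ` by the geometric mean
of the two diagonal entries with opposite values on `A` and `Aᶜ`. -/
lemma entanglementWitness_tensor_nonneg (i : Fin N) {z o : Fin d} (hzo : z ≠ o)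
    (A : Bipartition N) {σ : Op A.1 d} {τ : Op (A.1ᶜ : Finset (Fin N)) d} (hσ : IsState σ)
    (hτ : IsState τ) : 0 ≤ entanglementWitness i z o (tensor A.1 σ τ) := by
  obtain ⟨A, hA, hAc⟩ := A
  set T := tensor A σ τ with hT
  have hTpos : ∀ r, 0 ≤ (T r r).re := fun r => (Complex.nonneg_iff.1
    (mul_nonneg hσ.1.diag_nonneg hτ.1.diag_nonneg : 0 ≤ T r r)).1
  set u := witnessWeight i z o (twoValued A z o)
  set v := witnessWeight i z o (twoValued A o z)
  have huv : u * v = 1 := witnessWeight_mul_witnessWeight hA hAc i hzo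
  have hu : 0 ≤ u := witnessWeight_nonneg _ _ _ _
  have hv : 0 ≤ v := witnessWeight_nonneg _ _ _ _
  set x := (T (twoValued A z o) (twoValued A z o)).re with hx
  set y := (T (twoValued A o z) (twoValued A o z)).re with hy
  have hsum : u * x + v * y ≤ ∑ r, witnessWeight i z o r * (T r r).re := by
    have hne : twoValued A z o ≠ twoValued A o z := fun h =>
      hzo (twoValued_injective hA hAc h).1
    rw [← Finset.sum_pair (f := fun r => witnessWeight i z o r * (T r r).re) hne]
    exact Finset.sum_le_sum_of_subset_of_nonneg (Finset.subset_univ _)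
      fun r _ _ => mul_nonneg (witnessWeight_nonneg _ _ _ _) (hTpos r)
  set t := (T (fun _ => z) (fun _ => o)).re with ht
  have htxy : t ^ 2 ≤ x * y := by
    have h1 := normSq_apply_le hσ.1 (fun _ => z) (fun _ => o)
    have h2 := normSq_apply_le hτ.1 (fun _ => z) (fun _ => o)
    have hre : ∀ (w w' : ℂ), 0 ≤ w → (w * w').re = w.re * w'.re := fun w w' hw => by
      rw [Complex.mul_re, ← (Complex.nonneg_iff.1 hw).2, zero_mul, sub_zero]
    rw [hx, hy, hT, tensor_twoValued, tensor_twoValued, hre _ _ hσ.1.diag_nonneg,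
      hre _ _ hσ.1.diag_nonneg]
    have h3 : t ^ 2 ≤ Complex.normSq (T (fun _ => z) (fun _ => o)) := by
      rw [Complex.normSq_apply, ← ht]
      nlinarith [mul_self_nonneg (T (fun _ => z) (fun _ => o)).im]
    rw [hT, tensor, Complex.normSq_mul] at h3
    have h4 := mul_le_mul h1 h2 (Complex.normSq_nonneg _) ((Complex.normSq_nonneg _).trans h1)
    refine h3.trans (h4.trans_eq ?_)
    ring
  have hx0 : 0 ≤ x := hTpos _
  have hy0 : 0 ≤ y := hTpos _
  have hle : 2 * t ≤ u * x + v * y := by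
    refine le_of_sq_le_sq ?_ (by positivity)
    have : (u * x) * (v * y) = x * y := by
      rw [mul_mul_mul_comm, huv, one_mul]
    nlinarith [sq_nonneg (u * x - v * y)]
  unfold entanglementWitness
  linarith

lemma entanglementWitness_sum_smul (i : Fin N) (z o : Fin d) {a b : ℝ} (ρ σ : Op (Fin N) d) :
    entanglementWitness i z o (a • ρ + b • σ) =
      a * entanglementWitness i z o ρ + b * entanglementWitness i z o σ := by
  simp only [entanglementWitness, Matrix.add_apply, Matrix.smul_apply, Complex.add_re,
    Complex.smul_re, smul_eq_mul, mul_sub, Finset.mul_sum]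
  have : ∀ r, witnessWeight i z o r * (a * (ρ r r).re + b * (σ r r).re) =
      a * (witnessWeight i z o r * (ρ r r).re) + b * (witnessWeight i z o r * (σ r r).re) :=
    fun r => by ring
  simp only [this, Finset.sum_add_distrib]
  ring

theorem entanglementWitness_nonneg (hN : 0 < N) (i : Fin N) {z o : Fin d} (hzo : z ≠ o)
    {ρ : Op (Fin N) d} (hρ : ρ ∈ separableStates N d (N - 1)) :
    0 ≤ entanglementWitness i z o ρ := by
  have hconv : Convex ℝ {ρ : Op (Fin N) d | 0 ≤ entanglementWitness i z o ρ} := by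
    intro ρ hρ σ hσ a b ha hb _
    rw [Set.mem_ofPred_eq, entanglementWitness_sum_smul]
    exact add_nonneg (mul_nonneg ha hρ) (mul_nonneg hb hσ)
  refine convexHull_min (fun ρ hρ => ?_) hconv hρ
  obtain ⟨A, σ, τ, hσ, hτ, rfl⟩ := exists_tensor_of_mem_productStates hN hρ
  exact entanglementWitness_tensor_nonneg i hzo A hσ hτ

end Witness

/-! ### Embedding operators along an injection of basis vectors -/

section Push

variable {m n : Type} [Fintype m] [DecidableEq n]

/-- The operator on `ℂ^n` obtained from one on `ℂ^m` by the linear map `|p⟩ ↦ |e p⟩`. -/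
noncomputable def push (e : m → n) (R : Matrix m m ℂ) : Matrix n n ℂ :=
  (1 : Matrix n n ℂ).submatrix id e * R * ((1 : Matrix n n ℂ).submatrix id e).conjTranspose

lemma trace_push_mul [Fintype n] (e : m → n) (R : Matrix m m ℂ) (X : Matrix n n ℂ) :
    (push e R * X).trace = (R * X.submatrix e e).trace := by
  have h : ((1 : Matrix n n ℂ).submatrix id e).conjTranspose * X *
      (1 : Matrix n n ℂ).submatrix id e = X.submatrix e e := by
    ext p q
    simp [Matrix.mul_apply, Matrix.one_apply, Matrix.submatrix_apply]
  rw [push, Matrix.mul_assoc, Matrix.mul_assoc, Matrix.trace_mul_comm, Matrix.mul_assoc, h]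

variable {e : m → n}

lemma IsState.push [DecidableEq m] [Fintype n] (he : Function.Injective e) {R : Matrix m m ℂ}
    (hR : IsState R) :
    IsState (push e R) := by
  refine ⟨hR.1.mul_mul_conjTranspose_same _, ?_⟩
  rw [← mul_one (GenuineCorr.push e R), trace_push_mul, Matrix.submatrix_one e he, mul_one, hR.2]

lemma push_apply_apply [DecidableEq m] (he : Function.Injective e) (R : Matrix m m ℂ) (p q : m) :
    push e R (e p) (e q) = R p q := by
  simp [push, Matrix.mul_apply, Matrix.one_apply, he.eq_iff]

lemma sum_mul_push_apply [DecidableEq m] [Fintype n] (he : Function.Injective e)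
    (R : Matrix m m ℂ) (f : n → ℂ) :
    ∑ r, f r * push e R r r = ∑ p, f (e p) * R p p := by
  have h := trace_push_mul e R (Matrix.diagonal f)
  rw [Matrix.submatrix_diagonal _ _ he, Matrix.trace_mul_comm, Matrix.trace_mul_comm R] at h
  simpa only [Matrix.trace, Matrix.diag_apply, Matrix.diagonal_mul, Function.comp_apply] using h

end Push

/-! ### Qubit operators in Bloch coordinates -/

section Bloch

/-- The coefficient of the identity in the expansion of a Hermitian `2 × 2` matrix in Pauli
matrices. -/
noncomputable def scal (E : Matrix (Fin 2) (Fin 2) ℂ) : ℝ := ((E 0 0).re + (E 1 1).re) / 2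

/-- The coefficients of the Pauli matrices in the expansion of a Hermitian `2 × 2` matrix. -/
noncomputable def vec (E : Matrix (Fin 2) (Fin 2) ℂ) : Fin 3 → ℝ :=
  ![(E 0 1).re, -(E 0 1).im, ((E 0 0).re - (E 1 1).re) / 2]

lemma trace_mul_eq_bloch {E F : Matrix (Fin 2) (Fin 2) ℂ} (hE : E.IsHermitian)
    (hF : F.IsHermitian) :
    (E * F).trace.re = 2 * (scal E * scal F + ∑ i, vec E i * vec F i) := by
  have hE1 : E 1 0 = star (E 0 1) := (hE.apply 1 0).symm
  have hF1 : F 1 0 = star (F 0 1) := (hF.apply 1 0).symm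
  have im0 : ∀ {G : Matrix (Fin 2) (Fin 2) ℂ}, G.IsHermitian → ∀ i, (G i i).im = 0 :=
    fun hG i => Complex.conj_eq_iff_im.1 (hG.apply i i)
  simp only [Matrix.trace_fin_two, Matrix.mul_apply, Fin.sum_univ_two, Fin.sum_univ_three, scal,
    vec, hE1, hF1, Complex.add_re, Complex.mul_re, Complex.star_def, Complex.conj_re,
    Complex.conj_im, im0 hE, im0 hF, Matrix.cons_val_zero, Matrix.cons_val_one, Matrix.cons_val]
  ring

lemma scal_nonneg {E : Matrix (Fin 2) (Fin 2) ℂ} (hE : E.PosSemidef) : 0 ≤ scal E := by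
  have h : ∀ i, 0 ≤ (E i i).re := fun i => (Complex.nonneg_iff.1 hE.diag_nonneg).1
  exact div_nonneg (add_nonneg (h 0) (h 1)) two_pos.le

lemma sum_vec_sq_le {E : Matrix (Fin 2) (Fin 2) ℂ} (hE : E.PosSemidef) :
    ∑ i, vec E i ^ 2 ≤ scal E ^ 2 := by
  have h := normSq_apply_le hE 0 1
  rw [Complex.normSq_apply] at h
  simp only [Fin.sum_univ_three, scal, vec, Matrix.cons_val_zero, Matrix.cons_val_one,
    Matrix.cons_val]
  nlinarith

lemma sq_vec_le (E : Matrix (Fin 2) (Fin 2) ℂ) (i : Fin 3) : vec E i ^ 2 ≤ ∑ i, vec E i ^ 2 :=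
  Finset.single_le_sum (f := fun i => vec E i ^ 2) (fun _ _ => sq_nonneg _) (Finset.mem_univ i)

lemma vec_eq_zero {E : Matrix (Fin 2) (Fin 2) ℂ} (hE : E.PosSemidef) (h : scal E = 0) (i : Fin 3) :
    vec E i = 0 := by
  have h1 := (sq_vec_le E i).trans (sum_vec_sq_le hE)
  rw [h] at h1
  nlinarith

lemma sum_scal {K : Type} [Fintype K] {E : K → Matrix (Fin 2) (Fin 2) ℂ} (h : ∑ a, E a = 1) :
    ∑ a, scal (E a) = 1 := by
  have h' : ∀ i, ∑ a, (E a i i).re = 1 := fun i => by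
    rw [← Complex.re_sum, ← Matrix.sum_apply, h, Matrix.one_apply_eq, Complex.one_re]
  simp only [scal, ← Finset.sum_div, Finset.sum_add_distrib, h']
  norm_num

lemma sum_vec {K : Type} [Fintype K] {E : K → Matrix (Fin 2) (Fin 2) ℂ} (h : ∑ a, E a = 1)
    (i : Fin 3) : ∑ a, vec (E a) i = 0 := by
  have h' : ∀ i, ∑ a, (E a i i).re = 1 := fun i => by
    rw [← Complex.re_sum, ← Matrix.sum_apply, h, Matrix.one_apply_eq, Complex.one_re]
  have h01 : ∑ a, E a 0 1 = 0 := by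
    rw [← Matrix.sum_apply, h, Matrix.one_apply_ne (by decide)]
  fin_cases i
  · simp [vec, ← Complex.re_sum, h01]
  · simp [vec, ← Complex.im_sum, h01]
  · simp [vec, ← Finset.sum_div, h']

/-- The qubit state with Bloch vector `v`. -/
noncomputable def blochState (v : Fin 3 → ℝ) : Matrix (Fin 2) (Fin 2) ℂ :=
  !![⟨(1 + v 2) / 2, 0⟩, ⟨v 0 / 2, -(v 1 / 2)⟩; ⟨v 0 / 2, v 1 / 2⟩, ⟨(1 - v 2) / 2, 0⟩]

/-- For a unit vector `v` the matrix `blochState v` is a projection. -/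
lemma isState_blochState {v : Fin 3 → ℝ} (hv : ∑ i, v i ^ 2 = 1) : IsState (blochState v) := by
  rw [Fin.sum_univ_three] at hv
  have h : (blochState v).conjTranspose * blochState v = blochState v := by
    ext i j
    fin_cases i <;> fin_cases j <;> apply Complex.ext <;>
      simp [blochState, Matrix.mul_apply, Matrix.conjTranspose_apply, Fin.sum_univ_two] <;> linarith
  refine ⟨h ▸ Matrix.posSemidef_conjTranspose_mul_self _, ?_⟩
  apply Complex.ext
  · simp [blochState, Matrix.trace_fin_two]
    ring
  · simp [blochState, Matrix.trace_fin_two]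

lemma scal_blochState (v : Fin 3 → ℝ) : scal (blochState v) = 1 / 2 := by
  simp [scal, blochState]
  ring

lemma vec_blochState (v : Fin 3 → ℝ) (i : Fin 3) : vec (blochState v) i = v i / 2 := by
  fin_cases i <;> simp [vec, blochState]
  ring

end Bloch

/-! ### The octahedral hidden state model -/

section Octahedron

/-- The vertices `±eᵢ` of the octahedron in the Bloch ball; `true` stands for the sign `+`. -/
def vertex (k : Fin 3 × Bool) : Fin 3 → ℝ := Pi.single k.1 (if k.2 then 1 else -1)

lemma sum_vertex_sq (k : Fin 3 × Bool) : ∑ i, vertex k i ^ 2 = 1 := by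
  rw [Finset.sum_eq_single k.1 (fun i _ hi => by simp [vertex, hi]) (by simp)]
  rcases k with ⟨i, s⟩
  cases s <;> simp [vertex]

/-- The preference of the hidden state `k` for the effect `E = m₀ + m·σ`, homogeneous of degree one
in `E`. The first summand would do for pure `E`; the second one makes the weighted sum
`∑ k, pref E k • |k⟩⟨k|` linear in `E` in general. For `E = 0` it is `0`. -/
noncomputable def pref (E : Matrix (Fin 2) (Fin 2) ℂ) (k : Fin 3 × Bool) : ℝ :=
  (scal E + ∑ i, vertex k i * vec E i) ^ 2 / (2 * scal E) +
    (scal E ^ 2 - ∑ i, vec E i ^ 2) / (6 * scal E)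

lemma sum_vertex_mul (k : Fin 3 × Bool) (v : Fin 3 → ℝ) :
    ∑ i, vertex k i * v i = (if k.2 then 1 else -1) * v k.1 := by
  rw [Finset.sum_eq_single k.1 (fun i _ hi => by simp [vertex, hi]) (by simp)]
  simp [vertex]

lemma pref_nonneg {E : Matrix (Fin 2) (Fin 2) ℂ} (hE : E.PosSemidef) (k : Fin 3 × Bool) :
    0 ≤ pref E k := by
  have h0 := scal_nonneg hE
  exact add_nonneg (div_nonneg (sq_nonneg _) (by positivity))
    (div_nonneg (sub_nonneg.2 (sum_vec_sq_le hE)) (by positivity))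

lemma pref_le {E : Matrix (Fin 2) (Fin 2) ℂ} (hE : E.PosSemidef) (k : Fin 3 × Bool) :
    pref E k ≤ scal E + ∑ i, vertex k i * vec E i := by
  rcases (scal_nonneg hE).eq_or_lt with h0 | h0
  · simp [pref, vec_eq_zero hE h0.symm, ← h0]
  · have h1 := sum_vec_sq_le hE
    have h2 := sq_vec_le E k.1
    rw [pref, sum_vertex_mul]
    have hs : (if k.2 then (1 : ℝ) else -1) ^ 2 = 1 := by split_ifs <;> norm_num
    generalize (if k.2 then (1 : ℝ) else -1) = s at hs ⊢
    rw [div_add_div _ _ (by positivity) (by positivity), div_le_iff₀ (by positivity)]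
    have h3 : (s * vec E k.1) ^ 2 = vec E k.1 ^ 2 := by rw [mul_pow, hs, one_mul]
    nlinarith

/-- The preferences never add up to more than one. -/
lemma sum_pref_le_one {K : Type} [Fintype K] {E : K → Matrix (Fin 2) (Fin 2) ℂ}
    (hE : ∀ a, (E a).PosSemidef) (h : ∑ a, E a = 1) (k : Fin 3 × Bool) :
    ∑ a, pref (E a) k ≤ 1 := by
  refine (Finset.sum_le_sum fun a _ => pref_le (hE a) k).trans_eq ?_
  rw [Finset.sum_add_distrib, sum_scal h, Finset.sum_comm]
  simp only [← Finset.mul_sum, sum_vec h, mul_zero, Finset.sum_const_zero, add_zero]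

/-- The sum `∑ k, pref E k • |k⟩⟨k|`, tested against `f₀ + f·σ`: the result is linear in
`E`. -/
lemma sum_pref_mul {E : Matrix (Fin 2) (Fin 2) ℂ} (hE : E.PosSemidef) (f₀ : ℝ) (f : Fin 3 → ℝ) :
    ∑ k, pref E k * (f₀ + ∑ i, vertex k i * f i) =
      4 * scal E * f₀ + 2 * ∑ i, vec E i * f i := by
  rcases (scal_nonneg hE).eq_or_lt with h0 | h0
  · simp [pref, vec_eq_zero hE h0.symm, ← h0]
  · simp only [pref, sum_vertex_mul]
    simp only [Fintype.sum_prod_type, Fin.sum_univ_three, Fintype.sum_bool, if_true,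
      Bool.false_eq_true, if_false]
    field_simp
    ring

/-- The response to the hidden state `k`: outcomes are chosen according to `pref`, and what is left
of the probability is distributed as by measuring `|0⟩`. -/
noncomputable def octahedronResponse {K : Type} [Fintype K] (E : K → Matrix (Fin 2) (Fin 2) ℂ)
    (k : Fin 3 × Bool) (a : K) : ℝ :=
  pref (E a) k + (1 - ∑ b, pref (E b) k) * (E a 0 0).re

variable {K : Type} [Fintype K] {E : K → Matrix (Fin 2) (Fin 2) ℂ}

lemma octahedronResponse_nonneg (hE : ∀ a, (E a).PosSemidef) (h : ∑ a, E a = 1)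
    (k : Fin 3 × Bool) (a : K) : 0 ≤ octahedronResponse E k a :=
  add_nonneg (pref_nonneg (hE a) k) (mul_nonneg (sub_nonneg.2 (sum_pref_le_one hE h k))
    (Complex.nonneg_iff.1 (hE a).diag_nonneg).1)

lemma sum_octahedronResponse (h : ∑ a, E a = 1) (k : Fin 3 × Bool) :
    ∑ a, octahedronResponse E k a = 1 := by
  have h' : ∑ a, (E a 0 0).re = 1 := by
    rw [← Complex.re_sum, ← Matrix.sum_apply, h, Matrix.one_apply_eq, Complex.one_re]
  simp only [octahedronResponse, Finset.sum_add_distrib, ← Finset.mul_sum, h']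
  ring

/-- Six times the unnormalized state that the outcome `a` leaves on the other side, tested against
`F`. -/
lemma sum_octahedronResponse_mul (hE : ∀ a, (E a).PosSemidef) (h : ∑ a, E a = 1) (a : K)
    {F : Matrix (Fin 2) (Fin 2) ℂ} (hF : F.IsHermitian) :
    ∑ k, octahedronResponse E k a * (blochState (vertex k) * F).trace.re =
      (E a * F).trace.re + 2 * scal (E a) * scal F + 2 * (E a 0 0).re * scal F := by
  have htr : ∀ k, (blochState (vertex k) * F).trace.re = scal F + ∑ i, vertex k i * vec F i := by
    intro k
    rw [trace_mul_eq_bloch (isState_blochState (sum_vertex_sq k)).1.1 hF, scal_blochState]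
    simp only [vec_blochState, Fin.sum_univ_three]
    ring
  have hall : ∑ k, (scal F + ∑ i, vertex k i * vec F i) = 6 * scal F := by
    simp only [sum_vertex_mul]
    simp only [Fintype.sum_prod_type, Fin.sum_univ_three, Fintype.sum_bool, if_true,
      Bool.false_eq_true, if_false]
    ring
  have hres : ∑ b, ∑ k, pref (E b) k * (scal F + ∑ i, vertex k i * vec F i) = 4 * scal F := by
    simp only [sum_pref_mul (hE _), Finset.sum_add_distrib, ← Finset.mul_sum, ← Finset.sum_mul,
      sum_scal h]
    rw [Finset.sum_comm]
    simp only [← Finset.sum_mul, sum_vec h, zero_mul, Finset.sum_const_zero]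
    ring
  rw [Finset.sum_comm] at hres
  have hexp : ∀ k, octahedronResponse E k a * (blochState (vertex k) * F).trace.re =
      pref (E a) k * (scal F + ∑ i, vertex k i * vec F i) +
        (E a 0 0).re * ((scal F + ∑ i, vertex k i * vec F i) -
          ∑ b, pref (E b) k * (scal F + ∑ i, vertex k i * vec F i)) := by
    intro k
    rw [htr, octahedronResponse, ← Finset.sum_mul]
    ring
  simp only [hexp]
  rw [Finset.sum_add_distrib, ← Finset.mul_sum, Finset.sum_sub_distrib, hall, hres,
    sum_pref_mul (hE a), trace_mul_eq_bloch (hE a).1 hF]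
  ring

end Octahedron

/-! ### A genuinely multipartite entangled state that is not steerable -/

/-- The two-qubit state `(|Ω⟩⟨Ω| + (½ I + |0⟩⟨0|) ⊗ I) / 6` with `Ω = |00⟩ + |11⟩`. -/
noncomputable def seedState : Matrix (Fin 2 × Fin 2) (Fin 2 × Fin 2) ℂ :=
  (1 / 6 : ℝ) • (Matrix.of (fun p q => if p.1 = p.2 ∧ q.1 = q.2 then 1 else 0) +
    Matrix.diagonal fun p => if p.1 = 0 then 3 / 2 else 1 / 2)

lemma isState_seedState : IsState seedState := by
  refine ⟨Matrix.PosSemidef.smul (Matrix.PosSemidef.add ?_ (.diagonal fun p => ?_))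
    (by norm_num : (0 : ℝ) ≤ 1 / 6), ?_⟩
  · have h := Matrix.posSemidef_vecMulVec_self_star (R := ℂ)
      (fun p : Fin 2 × Fin 2 => if p.1 = p.2 then 1 else 0)
    convert h using 1
    ext p q
    by_cases h1 : p.1 = p.2 <;> by_cases h2 : q.1 = q.2 <;> simp [Matrix.vecMulVec_apply, h1, h2]
  · dsimp only
    split_ifs <;> norm_num [Complex.nonneg_iff]
  · simp [seedState, Matrix.trace, Fintype.sum_prod_type, Fin.sum_univ_two]
    norm_num

/-- The two computational basis vectors `|b…b⟩`, `b = 0, 1`, of the qudits in `ι`. -/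
def constConfig (ι : Type) {d : ℕ} (hd : 2 ≤ d) (b : Fin 2) : ι → Fin d := fun _ => Fin.castLE hd b

lemma constConfig_injective {ι : Type} [Nonempty ι] {d : ℕ} (hd : 2 ≤ d) :
    Function.Injective (constConfig ι hd) := fun _ _ h =>
  Fin.castLE_injective hd (congr_fun h (Classical.arbitrary ι))

section NonsteerableState

variable {N d : ℕ}

/-- The basis vector of all parties with value `p.1` on `A` and `p.2` off `A`. -/
def pairConfig (A : Finset (Fin N)) (hd : 2 ≤ d) (p : Fin 2 × Fin 2) : Fin N → Fin d :=
  twoValued A (Fin.castLE hd p.1) (Fin.castLE hd p.2)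

lemma pairConfig_injective (A : Bipartition N) (hd : 2 ≤ d) :
    Function.Injective (pairConfig A.1 hd) := fun _ _ h =>
  have h' := twoValued_injective A.2.1 A.2.2 h
  Prod.ext (Fin.castLE_injective hd h'.1) (Fin.castLE_injective hd h'.2)

/-- The state `seedState` distributed over `A | Aᶜ`, each of whose sides encodes its qubit in the
span of `|0…0⟩` and `|1…1⟩`. -/
noncomputable def spreadState (A : Bipartition N) (hd : 2 ≤ d) : Op (Fin N) d :=
  push (pairConfig A.1 hd) seedState

lemma isState_spreadState (A : Bipartition N) (hd : 2 ≤ d) : IsState (spreadState A hd) :=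
  isState_seedState.push (pairConfig_injective A hd)

/-- The values `½` and `2` of the weights on the configurations `01` and `10` give
`½ · 3/2 + 2 · ½ < 2`, up to the factor `1/6`. -/
lemma entanglementWitness_spreadState_neg (A : Bipartition N) (hd : 2 ≤ d) :
    ∃ (i : Fin N) (z o : Fin d), z ≠ o ∧ entanglementWitness i z o (spreadState A hd) < 0 := by
  obtain ⟨i, hi⟩ := A.2.1
  set z : Fin d := Fin.castLE hd 0 with hz
  set o : Fin d := Fin.castLE hd 1 with ho
  have hzo : z ≠ o := fun h => absurd (Fin.castLE_injective hd h) (by decide)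
  have hinj := pairConfig_injective A hd
  refine ⟨i, z, o, hzo, ?_⟩
  have hsum := sum_mul_push_apply hinj seedState fun r => (witnessWeight i z o r : ℂ)
  have hw0 : ∀ a : Fin 2, witnessWeight i z o (pairConfig A.1 hd (a, a)) = 0 := fun a => by
    rw [pairConfig, twoValued_self]
    refine if_pos ?_
    fin_cases a
    · exact Or.inl rfl
    · exact Or.inr rfl
  have hw01 : witnessWeight i z o (pairConfig A.1 hd (0, 1)) = 1 / 2 :=
    (witnessWeight_twoValued A.2.1 A.2.2 i hzo).trans (if_pos (if_pos hi))
  have hw10 : witnessWeight i z o (pairConfig A.1 hd (1, 0)) = 2 :=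
    (witnessWeight_twoValued A.2.1 A.2.2 i hzo.symm).trans
      (if_neg fun h => hzo (h.symm.trans (if_pos hi)))
  have hcoh : spreadState A hd (fun _ => z) (fun _ => o) = 1 / 6 := by
    have h := push_apply_apply hinj seedState (0, 0) (1, 1)
    simp only [pairConfig, twoValued_self, ← hz, ← ho] at h
    refine h.trans ?_
    simp [seedState]
  have hdiag : ∑ r, witnessWeight i z o r * (spreadState A hd r r).re = 7 / 24 := by
    have h := congrArg Complex.re hsum
    simp only [Complex.re_sum, Complex.re_ofReal_mul, Fintype.sum_prod_type, Fin.sum_univ_two,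
      hw0, hw01, hw10] at h
    refine h.trans ?_
    simp [seedState]
    norm_num
  rw [entanglementWitness, hdiag, hcoh]
  norm_num

lemma spreadState_mem_GME (hN : 0 < N) (A : Bipartition N) (hd : 2 ≤ d) :
    spreadState A hd ∈ GME N d := by
  obtain ⟨i, z, o, hzo, hlt⟩ := entanglementWitness_spreadState_neg A hd
  exact (mem_GME_iff (isState_spreadState A hd)).2 fun h =>
    hlt.not_ge (entanglementWitness_nonneg hN i hzo h)

/-- The effects of joint measurements on the qubit encoded in the span of `|0…0⟩` and `|1…1⟩`. -/
noncomputable def encodedEffect {ι : Type} [Fintype ι] (hd : 2 ≤ d) (x : ι → Measurement d)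
    (a : Outcome x) : Matrix (Fin 2) (Fin 2) ℂ :=
  (jointEffect x a).submatrix (constConfig ι hd) (constConfig ι hd)

lemma posSemidef_encodedEffect {ι : Type} [Fintype ι] [DecidableEq ι] (hd : 2 ≤ d)
    (x : ι → Measurement d) (a : Outcome x) : (encodedEffect hd x a).PosSemidef :=
  (posSemidef_jointEffect x a).submatrix _

lemma sum_transpose_encodedEffect {ι : Type} [Fintype ι] [DecidableEq ι] [Nonempty ι] (hd : 2 ≤ d)
    (x : ι → Measurement d) : ∑ a, (encodedEffect hd x a).transpose = 1 := by
  rw [← Matrix.transpose_sum]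
  have h : ∑ a, encodedEffect hd x a =
      (∑ a, jointEffect x a).submatrix (constConfig ι hd) (constConfig ι hd) := by
    ext i j
    simp [encodedEffect, Matrix.sum_apply]
  rw [h, sum_jointEffect, Matrix.submatrix_one _ (constConfig_injective hd), Matrix.transpose_one]

lemma born_push_constConfig {ι : Type} [Fintype ι] [DecidableEq ι] (hd : 2 ≤ d)
    (R : Matrix (Fin 2) (Fin 2) ℂ) (x : ι → Measurement d) (a : Outcome x) :
    born (push (constConfig ι hd) R) x a = (R * encodedEffect hd x a).trace.re := by
  rw [born, trace_push_mul, encodedEffect]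

/-- The two-qubit statistics of `seedState`. The transpose comes from
`⟨Ω| E ⊗ F |Ω⟩ = tr Eᵀ F`. -/
lemma trace_seedState_mul {E F : Matrix (Fin 2) (Fin 2) ℂ} (hE : E.IsHermitian)
    (hF : F.IsHermitian) :
    (seedState * Matrix.of fun p q : Fin 2 × Fin 2 => E p.1 q.1 * F p.2 q.2).trace.re =
      (1 / 6) * ((E.transpose * F).trace.re + 2 * scal E.transpose * scal F +
        2 * (E.transpose 0 0).re * scal F) := by
  have im0 : ∀ {G : Matrix (Fin 2) (Fin 2) ℂ}, G.IsHermitian → ∀ i, (G i i).im = 0 :=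
    fun hG i => Complex.conj_eq_iff_im.1 (hG.apply i i)
  simp [seedState, Matrix.trace, Matrix.mul_apply, Fintype.sum_prod_type, Fin.sum_univ_two,
    Matrix.diagonal_apply, scal, im0 hE, im0 hF]
  ring

lemma born_spreadState (A : Bipartition N) (hd : 2 ≤ d) (x : Fin N → Measurement d)
    (a : Outcome x) :
    born (spreadState A hd) x a =
      ∑ k, (1 / 6 : ℝ) * (octahedronResponse
        (fun b => (encodedEffect hd (fun i : A.1 => x i) b).transpose) k (fun i => a i) *
        born (push (constConfig _ hd) (blochState (vertex k)))
          (fun i : (A.1ᶜ : Finset (Fin N)) => x i) fun i => a i) := by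
  have : Nonempty A.1 := A.2.1.coe_sort
  have hsub : (jointEffect x a).submatrix (pairConfig A.1 hd) (pairConfig A.1 hd) =
      Matrix.of fun p q => encodedEffect hd (fun i : A.1 => x i) (fun i => a i) p.1 q.1 *
        encodedEffect hd (fun i : (A.1ᶜ : Finset (Fin N)) => x i) (fun i => a i) p.2 q.2 := by
    ext p q
    rw [jointEffect_eq_tensor (A := A.1), Matrix.submatrix_apply, pairConfig, pairConfig,
      tensor_twoValued]
    rfl
  rw [born, spreadState, trace_push_mul, hsub,
    trace_seedState_mul (posSemidef_encodedEffect hd _ _).1 (posSemidef_encodedEffect hd _ _).1,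
    ← Finset.mul_sum]
  simp only [born_push_constConfig]
  rw [sum_octahedronResponse_mul (fun b => (posSemidef_encodedEffect hd _ b).transpose)
    (sum_transpose_encodedEffect hd _) _ (posSemidef_encodedEffect hd _ _).1]

/-- The model with six equiprobable hidden states, the vertices of the octahedron. They are encoded
in the span of `|0…0⟩` and `|1…1⟩` on `Aᶜ`, and `A` responds to the transposed encoded effects. -/
noncomputable def octahedronModel (A : Bipartition N) (hd : 2 ≤ d) : LHSModel N d A.1 :=
  have : Nonempty A.1 := A.2.1.coe_sort
  have : Nonempty (A.1ᶜ : Finset (Fin N)) := A.2.2.coe_sort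
  LHSModel.discrete (PMF.uniformOfFintype (Fin 3 × Bool))
    (fun k x a => octahedronResponse (fun b => (encodedEffect hd x b).transpose) k a)
    (fun k x a => octahedronResponse_nonneg
      (fun b => (posSemidef_encodedEffect hd x b).transpose) (sum_transpose_encodedEffect hd x) k a)
    (fun k x => sum_octahedronResponse (sum_transpose_encodedEffect hd x) k)
    (fun k => push (constConfig _ hd) (blochState (vertex k)))
    (fun k => (isState_blochState (sum_vertex_sq k)).push (constConfig_injective hd))

lemma prob_octahedronModel (A : Bipartition N) (hd : 2 ≤ d) (x : Fin N → Measurement d)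
    (a : Outcome x) : (octahedronModel A hd).prob x a = born (spreadState A hd) x a := by
  rw [octahedronModel, LHSModel.prob_discrete, born_spreadState]
  refine Finset.sum_congr rfl fun k _ => ?_
  congr 1
  simp [PMF.uniformOfFintype_apply]

lemma hybridLHS_spreadState (A₀ : Bipartition N) (hd : 2 ≤ d) :
    HybridLHS (spreadState A₀ hd) := by
  classical
  refine ⟨Pi.single A₀ 1, fun A => octahedronModel A hd,
    fun A => by rw [Pi.single_apply]; split_ifs <;> norm_num, by simp, fun x a => ?_⟩
  rw [Finset.sum_eq_single A₀ (fun A _ hA => by rw [Pi.single_eq_of_ne hA, zero_mul])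
    (fun h => absurd (Finset.mem_univ _) h), Pi.single_eq_same, one_mul, prob_octahedronModel]

end NonsteerableState

theorem GME_sdiff_GMS_nonempty {N d : ℕ} (hN : 2 ≤ N) (hd : 2 ≤ d) :
    ∃ ρ ∈ GME N d, ρ ∉ GMS N d := by
  let i : Fin N := ⟨0, by omega⟩
  let A : Bipartition N := ⟨{i}, Finset.singleton_nonempty i, by
    rw [← Finset.card_pos, Finset.card_compl, Fintype.card_fin, Finset.card_singleton]
    omega⟩
  exact ⟨spreadState A hd, spreadState_mem_GME (by omega) A hd,
    fun h => h.2 (hybridLHS_spreadState A hd)⟩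

end GenuineCorr

theorem theorem1 (N d : ℕ) (hN : 2 ≤ N) :
    (GenuineCorr.GMD N d ⊆ GenuineCorr.GMT N d ∧
      GenuineCorr.GME N d ⊆ GenuineCorr.GMD N d ∧
      GenuineCorr.GMS N d ⊆ GenuineCorr.GME N d ∧
      GenuineCorr.GMNL N d ⊆ GenuineCorr.GMS N d) ∧
    (2 ≤ d →
      GenuineCorr.GME N d ⊂ GenuineCorr.GMT N d ∧
      GenuineCorr.GMS N d ⊂ GenuineCorr.GME N d) := by
  have hTD := GenuineCorr.GMD_subset_GMT N d
  have hDE := GenuineCorr.GME_subset_GMD N d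
  have hES := GenuineCorr.GMS_subset_GME (N := N) d (by omega)
  refine ⟨⟨hTD, hDE, hES, GenuineCorr.GMNL_subset_GMS N d⟩, fun hd => ⟨?_, ?_⟩⟩
  · obtain ⟨ρ, hρ, hρ'⟩ := GenuineCorr.GMT_sdiff_GME_nonempty hN hd
    exact ⟨hDE.trans hTD, fun h => hρ' (h hρ)⟩
  · obtain ⟨ρ, hρ, hρ'⟩ := GenuineCorr.GME_sdiff_GMS_nonempty hN hd
    exact ⟨hES, fun h => hρ' (h hρ)⟩
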